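/- Conventions. For integers $x,y$ put $\binom{x}{y}=x(x-1)\cdots(x-y+1)/y!$ if $y>0$, $\binom{x}{0}=1$, and $\binom{x}{y}=0$ if $y<0$. Let $n\ge 0$, $k\ge 1$, and let $S\subseteq\binom{[n]}{k}$ be a family of $k$-subsets of $[n]$, with iterated lower shadows $\Delta^i(S)$. A shadow $k$-binomial decomposition of $S$ is a sequence of integers $\beta_0>\beta_1>\dots>\beta_{k-2}\ge\beta_{k-1}$ with $|\Delta^i(S)|=\sum_{l=0}^{k-1}\binom{\beta_l}{k-i-l}$ for all $0\le i\le k-1$. An identity between two formal sums of binomial symbols with integer coefficients is translation invariant, written $\doteq$, if it remains true whenever any integer $r$ is added to all upper entries and any integer $s$ to all lower entries. Hypergraph. The edges of the hypergraph of $S$ are the sets $e\subseteq[n]$, $1\le|e|\le k$, that are minimal under inclusion with the property $e\notin\Delta^{k-|e|}(S)$. List them as $e_1,e_2,\dots$ in any order of weakly increasing size. Let $B_j$ be the set of all $s\subseteq[n]\setminus e_j$ that meet every $e_i$ with $i<j$ and are minimal under inclusion with these properties; order each $B_j$ arbitrarily. Trees. The rooted tree $T_{e_j}$ is built as follows. Each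 internal vertex $u$ belongs to a set of $B_j$; the root belongs to the first one. If $u$ belongs to $s_i$, let $L_e$ be the union of the labels of the tree edges on the path from $u$ to the root, and let the label of $u$ be $s_i$ minus the union of the labels of the other vertices of that path; let $L_v$ be the union of all vertex labels of the path, including that of $u$. Then $u$ gets one leaf, labelled $(L_v,L_e)$, and, for each nonempty subset $s$ of the label of $u$ such that some set of $B_j$ is disjoint from $L_e\cup s$, a child that is an internal vertex, belongs to the first such set of $B_j$, and is joined to $u$ by a tree edge labelled $s$. Process. A ball $(j,s)$ has an integer position $j$ and an integer delay $s$. The initial configuration of $S$ has the wall at $w=0$ and, for each $j$ and each leaf of $T_{e_j}$ with label $(L_v,L_e)$, one ball with position $|L_v|-|L_e|$ and delay $|e_j|+|L_e|$; write $\mathcal B(S)$ for this multiset. In iteration $t=0,1,2,\dots$ the balls with delay $\le t$ are to be processed, and the others are kept for the next iteration. A ball $(j,s)$ that is to be processed can be legally processed if $j\le w$, where $w$ is the current position of the wall. It is then removed, balls $(j,s+1),(j+1,s+1),\dots,(w-1,s+1)$ are added (to be processed in this iteration if $s+1\le t$, and kept for the next one otherwise), and the wall moves to $w+1$. If there are balls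 to be processed and none of them can be legally processed, the process terminates abruptly. Otherwise the iteration ends when there are no more balls to be processed. Let $w_t$ be the position of the wall at the end of iteration $t$, and let $\mathcal B_{k+1}$ be the multiset of balls at the end of iteration $k$. Theorem 4. For all orderings as above the following holds. (i) The process started from the initial configuration of $S$ never terminates abruptly, in whatever order the legally processable balls are processed, and its sequence of configurations at the beginnings of the iterations $0,1,2,\dots$ is uniquely determined. (ii) $S$ has exactly one shadow $k$-binomial decomposition, namely $$(n-w_1-1,\;n-w_2-2,\;\ldots,\;n-w_{k-1}-(k-1),\;n-w_k-(k-1)).$$ (iii) The number $|S|$ is the value of the left-hand side of $$\binom{n}{k}-\sum_{(j,s)\in\mathcal B(S)}\binom{n-j-s}{k-s}\;\doteq\;\sum_{i=1}^{k-1}\binom{n-w_i-i}{k-i+1}+\binom{n-w_k-(k-1)}{1}-\sum_{(j,s)\in\mathcal B_{k+1}}\binom{n-j-s}{k-s},$$ this identity is translation invariant, and all balls of $\mathcal B_{k+1}$ have delay at least $k+1$. -/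

import Mathlib

/-! ## Binomial coefficients, shadows and the shadow binomial decomposition -/

/-- The binomial coefficient of two integers: `x (x - 1) ⋯ (x - y + 1) / y!` for `y > 0`,
`1` for `y = 0`, and `0` for `y < 0`. -/
def intBinom (x y : ℤ) : ℤ := if 0 ≤ y then Ring.choose x y.toNat else 0

/-- The `i`-th iterated lower shadow `Δ^i(S)`. -/
def iterShadow {n : ℕ} (i : ℕ) (S : Finset (Finset (Fin n))) : Finset (Finset (Fin n)) :=
  Finset.shadow^[i] S

/-- `β = (β_0, …, β_{k-1})` is a shadow `k`-binomial decomposition of the family `S` of `k`-sets: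
`β_0 > β_1 > ⋯ > β_{k-2} ≥ β_{k-1}`, and for `0 ≤ i ≤ k - 1`
`|Δ^i(S)| = binom (β_0) (k - i) + binom (β_1) (k - i - 1) + ⋯ + binom (β_{k-1}) (1 - i)`. -/
def IsShadowBinomialDecomposition {n : ℕ} (k : ℕ) (S : Finset (Finset (Fin n)))
    (β : Fin k → ℤ) : Prop :=
  (∀ i j : Fin k, i < j → (j : ℕ) + 1 < k → β j < β i) ∧
  (∀ i j : Fin k, i < j → β j ≤ β i) ∧
  ∀ i : ℕ, i < k →
    ((iterShadow i S).card : ℤ) = ∑ l : Fin k, intBinom (β l) ((k : ℤ) - i - (l : ℕ))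

/-! ## Formal sums of binomial coefficients and translation invariant identities -/

/-- A formal integer combination of binomial symbols; the pair `(x, y)` stands for
the symbol `binom x y`. -/
abbrev BinomialSum := (ℤ × ℤ) →₀ ℤ

/-- The formal symbol `binom x y`. -/
noncomputable def binomSymbol (x y : ℤ) : BinomialSum := Finsupp.single (x, y) 1

/-- The value of a formal sum after `r` is added to all upper and `s` to all lower entries. -/
noncomputable def BinomialSum.shiftedValue (E : BinomialSum) (r s : ℤ) : ℤ :=
  E.sum fun p c => c * intBinom (p.1 + r) (p.2 + s)

/-- The numerical value of a formal sum. -/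
noncomputable def BinomialSum.value (E : BinomialSum) : ℤ := E.shiftedValue 0 0

/-- The identity `E = F` is translation invariant. -/
def BinomialSum.TranslationEq (E F : BinomialSum) : Prop :=
  ∀ r s : ℤ, E.shiftedValue r s = F.shiftedValue r s

/-! ## The hypergraph of a family of `k`-sets -/

/-- `e` is an edge of the hypergraph of the family `S` of `k`-sets: `1 ≤ |e| ≤ k`,
`e ∉ Δ^{k-|e|}(S)`, and `e` is minimal under containment with these properties. -/
def IsHypergraphEdge {n : ℕ} (k : ℕ) (S : Finset (Finset (Fin n))) (e : Finset (Fin n)) : Prop :=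
  Minimal (fun f : Finset (Fin n) => 1 ≤ f.card ∧ f.card ≤ k ∧ f ∉ iterShadow (k - f.card) S) e

/-- `s` is, under containment, a minimal set of vertices that avoids `e` and meets every edge
in the list `prev`. -/
def IsMinimalDominating {n : ℕ} (prev : List (Finset (Fin n))) (e s : Finset (Fin n)) : Prop :=
  Minimal (fun t : Finset (Fin n) => Disjoint t e ∧ ∀ f ∈ prev, (t ∩ f).Nonempty) s

/-- The hypergraph of `S` with a comfortable ordering `e_1, e_2, …` of its edges (their sizes are
weakly increasing) and, for every edge `e_j`, an ordering of the set `B_j` of minimal sets that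
avoid `e_j` and dominate all earlier edges. -/
structure OrderedHypergraph {n : ℕ} (k : ℕ) (S : Finset (Finset (Fin n))) where
  edges : List (Finset (Fin n))
  edges_nodup : edges.Nodup
  mem_edges : ∀ e, e ∈ edges ↔ IsHypergraphEdge k S e
  comfortable : edges.Pairwise fun e f => e.card ≤ f.card
  dom : Fin edges.length → List (Finset (Fin n))
  dom_nodup : ∀ j, (dom j).Nodup
  mem_dom : ∀ j s, s ∈ dom j ↔ IsMinimalDominating (edges.take j) (edges.get j) s

/-! ## The tree attached to an edge -/

/-- The multiset of labels `(ℓ_v, ℓ_e)` of the leaves of a subtree of the tree `T_e` built from the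
ordered list `B` of dominating sets. `Lv` and `Le` are the unions of the vertex labels and of the
edge labels on the path from the root down to the place where the subtree is attached.

The subtree exists if some set of `B` is disjoint from `Le`. If `r` is the first such set, the top
vertex of the subtree is an internal vertex that belongs to `r` and has the label `r \ Lv`. It has
one leaf, labelled `(Lv ∪ r, Le)`, and for every nonempty `s ⊆ r \ Lv` a tree edge labelled `s`
whose other end carries the subtree for `Lv ∪ r` and `Le ∪ s`, if that subtree exists. -/
def leafLabels {n : ℕ} (B : List (Finset (Fin n))) (Lv Le : Finset (Fin n)) :
    Multiset (Finset (Fin n) × Finset (Fin n)) :=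
  match B.find? (fun s => decide (Disjoint s Le)) with
  | none => 0
  | some r =>
    (Lv ∪ r, Le) ::ₘ
      ∑ s ∈ ((r \ Lv).powerset.erase ∅).attach, leafLabels B (Lv ∪ r) (Le ∪ s.1)
termination_by Lvᶜ.card
decreasing_by
  have hs := s.2
  rw [Finset.mem_erase, Finset.mem_powerset] at hs
  obtain ⟨x, hx⟩ := Finset.nonempty_iff_ne_empty.mpr hs.1
  have hxr := Finset.mem_sdiff.mp (hs.2 hx)
  refine Finset.card_lt_card (Finset.ssubset_iff_of_subset ?_ |>.mpr ⟨x, ?_, ?_⟩)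
  · exact Finset.compl_subset_compl.mpr Finset.subset_union_left
  · exact Finset.mem_compl.mpr hxr.2
  · simp [hxr.1]

/-- The leaf labels of the whole tree: its root belongs to the first set of `B`. -/
def treeLeafLabels {n : ℕ} (B : List (Finset (Fin n))) :
    Multiset (Finset (Fin n) × Finset (Fin n)) :=
  leafLabels B ∅ ∅

/-! ## The bins-balls-wall process -/

/-- A ball, with its position (the bin that contains it) and its delay counter. -/
@[ext]
structure Ball where
  pos : ℤ
  delay : ℤ

/-- The multiset of balls and the position of the wall at the beginning of an iteration. -/
@[ext]
structure BallsWall where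
  balls : Multiset Ball
  wall : ℤ

/-- A state inside an iteration: the balls still to be processed, the balls put aside for the next
iteration, and the current position of the wall. -/
@[ext]
structure IterState where
  pending : Multiset Ball
  next : Multiset Ball
  wall : ℤ

/-- The balls at positions `b.pos, …, w - 1` with delay `b.delay + 1`. -/
noncomputable def descendants (b : Ball) (w : ℤ) : Multiset Ball :=
  (Finset.Ico b.pos w).val.map fun i => ⟨i, b.delay + 1⟩

/-- The state at the beginning of iteration `t`. -/
noncomputable def startIteration (t : ℕ) (c : BallsWall) : IterState where
  pending := c.balls.filter fun b => b.delay ≤ t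
  next := c.balls.filter fun b => ¬ b.delay ≤ t
  wall := c.wall

/-- One pending ball that is not to the right of the wall is processed during iteration `t`. -/
inductive ProcessBall (t : ℕ) : IterState → IterState → Prop
  | process (b : Ball) (D N : Multiset Ball) (w : ℤ) (legal : b.pos ≤ w) :
      ProcessBall t ⟨b ::ₘ D, N, w⟩
        ⟨if b.delay + 1 ≤ t then D + descendants b w else D,
          if b.delay + 1 ≤ t then N else N + descendants b w,
          w + 1⟩

/-- There are balls to be processed, and none of them can be legally processed. -/
def IterState.Stuck (x : IterState) : Prop :=
  x.pending ≠ 0 ∧ ∀ b ∈ x.pending, ¬ b.pos ≤ x.wall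

/-- Iteration `t`, with the balls processed in some order, leads from `c` to `c'`. -/
def Iteration (t : ℕ) (c c' : BallsWall) : Prop :=
  Relation.ReflTransGen (ProcessBall t) (startIteration t c) ⟨0, c'.balls, c'.wall⟩

/-- From `c₀` (at the beginning of iteration `0`) the process can be at `c` at the beginning of
iteration `t`. -/
inductive ReachedAt (c₀ : BallsWall) : ℕ → BallsWall → Prop
  | start : ReachedAt c₀ 0 c₀
  | step {t : ℕ} {c c' : BallsWall} :
      ReachedAt c₀ t c → Iteration t c c' → ReachedAt c₀ (t + 1) c'

/-- For some order of processing the balls, the process started at `c₀` terminates abruptly. -/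
def CanTerminateAbruptly (c₀ : BallsWall) : Prop :=
  ∃ (t : ℕ) (c : BallsWall) (x : IterState), ReachedAt c₀ t c ∧
    Relation.ReflTransGen (ProcessBall t) (startIteration t c) x ∧ x.Stuck

/-- `out` is an output of the process: `out t` is the configuration at the beginning of
iteration `t`. -/
def IsOutput (c₀ : BallsWall) (out : ℕ → BallsWall) : Prop :=
  out 0 = c₀ ∧ ∀ t, Iteration t (out t) (out (t + 1))

/-- The position of the wall at the end of iteration `t`. -/
def wallAtEnd (out : ℕ → BallsWall) (t : ℕ) : ℤ := (out (t + 1)).wall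

/-- The balls at the end of iteration `t`. -/
def ballsAtEnd (out : ℕ → BallsWall) (t : ℕ) : Multiset Ball := (out (t + 1)).balls

/-! ## The process of a family of `k`-sets -/

/-- The ball of a leaf labelled `(ℓ_v, ℓ_e)` in the tree of the edge `e`. The leaf gives the
coefficient `binom (n - |e| - |ℓ_v|) (k - |e| - |ℓ_e|)`, and this is `binom (n - j - s) (k - s)` for
the position `j = |ℓ_v| - |ℓ_e|` and the delay `s = |e| + |ℓ_e|`. -/
def leafBall {n : ℕ} (e : Finset (Fin n)) (p : Finset (Fin n) × Finset (Fin n)) : Ball where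
  pos := (p.1.card : ℤ) - p.2.card
  delay := (e.card : ℤ) + p.2.card

/-- The initial configuration of `S`: one ball for every leaf of every tree, and the wall at `0`. -/
def initialConfiguration {n k : ℕ} {S : Finset (Finset (Fin n))} (H : OrderedHypergraph k S) :
    BallsWall where
  balls := ∑ j : Fin H.edges.length, (treeLeafLabels (H.dom j)).map (leafBall (H.edges.get j))
  wall := 0

/-- The sequence `(n - w_1 - 1, n - w_2 - 2, …, n - w_{k-1} - (k - 1), n - w_k - (k - 1))`;
its entries are indexed from `0` to `k - 1`. -/
def wallSequence (n k : ℕ) (w : ℕ → ℤ) (l : Fin k) : ℤ :=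
  if (l : ℕ) + 1 < k then (n : ℤ) - w (l + 1) - ((l : ℕ) + 1) else (n : ℤ) - w k - ((k : ℤ) - 1)

/-- The formal sum of `binom (n - j - s) (k - s)` over the balls `(j, s)`. -/
noncomputable def ballsSum (n k : ℕ) (balls : Multiset Ball) : BinomialSum :=
  (balls.map fun b => binomSymbol ((n : ℤ) - b.pos - b.delay) ((k : ℤ) - b.delay)).sum

/-!
The proof combines a local analysis of the process, a lower bound for the position of the wall, and
a count.

*Process.* At the beginning of iteration `t` all delays are at least `t`, so the pending balls have
delay exactly `t` and their descendants wait for iteration `t + 1`. Two legal balls can be processed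
in either order with the same result (`ProcessBall.diamond`). Hence a single complete run determines
all runs and excludes abrupt termination, and only the existence of one complete run is at stake.
If a complete run exists, balls `(p, s)` can be added to the initial configuration whenever `p` is
at most the position of the wall at the end of iteration `s`, and each added ball moves the wall by
at least one (`IsOutput.exists_add`).

*Legality.* The edges are added one by one, and the balls of the tree of an edge are legal because
of the invariant `WallBound`: `q` distinct minimal transversals of the previous edges, all of size
at most `T`, cover at most `w + q - 1` vertices, where `w` is the position of the wall at the end of
iteration `T + q - 1`. A leaf with `|ℓ_e| = d` lies at the end of a path through at most `d + 1`
distinct minimal transversals with union `ℓ_v`, so the invariant shows that its ball is legal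
(`WallBound.leafBall_pos_le`). The invariant passes to one more edge `e` (`WallBound.append`): a
minimal transversal of the longer list either is one of the shorter list or becomes one after the
removal of its single vertex in `e`, and in the latter case it turns into a member of the list `B`
of `e`. The removed vertices are paid for by the balls of the new tree, because a tree on an
antichain `B` has at least `c` leaves with `|ℓ_e| < c` for each `c ≤ |B|`
(`le_card_filter_treeLeafLabels`).

*Identity and count.* By Pascal's rule the process preserves the formal sum of the initial
configuration when the wall at `w` in iteration `t` stands for the symbol of a ball at `(w, t - 1)`
(`Iteration.invariant`); this gives the translation invariant identity. The leaves of the trees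
partition the sets that contain an edge, so the initial balls count the shadows
(`OrderedHypergraph.card_iterShadow`). The remaining balls have delay at least `k + 1` and do not
contribute to any `|Δ^i(S)|` with `i < k`; so the walls give a shadow binomial decomposition. It is
the only one, because its defining equations are triangular (`eq_of_sum_intBinom_eq`).
-/

/-! ### Confluence of an iteration -/

theorem descendants_add_one {b : Ball} {w : ℤ} (h : b.pos ≤ w) :
    descendants b (w + 1) = ⟨w, b.delay + 1⟩ ::ₘ descendants b w := by
  rw [descendants, ← Finset.insert_Ico_right_eq_Ico_add_one h,
    Finset.insert_val_of_notMem (by simp), Multiset.map_cons, descendants]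

theorem mem_descendants {a b : Ball} {w : ℤ} :
    a ∈ descendants b w ↔ (b.pos ≤ a.pos ∧ a.pos < w) ∧ a.delay = b.delay + 1 := by
  simp only [descendants, Multiset.mem_map, Finset.mem_val, Finset.mem_Ico, Ball.ext_iff]
  constructor
  · rintro ⟨i, hi, rfl, h⟩
    exact ⟨hi, h.symm⟩
  · rintro ⟨hi, h⟩
    exact ⟨a.pos, hi, rfl, h.symm⟩

/-- Raising the wall only adds balls to the right of the old wall position. -/
theorem descendants_of_le {b : Ball} {w v : ℤ} (hb : b.pos ≤ w) (hv : w ≤ v) :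
    ∃ X : Multiset Ball, descendants b v = descendants b w + X ∧
      ∀ a ∈ X, a.delay = b.delay + 1 ∧ a.pos < v := by
  induction v, hv using Int.leInduction with
  | base => exact ⟨0, by simp, by simp⟩
  | succ v hv ih =>
    obtain ⟨X, hX, h⟩ := ih
    refine ⟨⟨v, b.delay + 1⟩ ::ₘ X, ?_, ?_⟩
    · rw [descendants_add_one (hb.trans hv), hX, Multiset.add_cons]
    · intro a ha
      rcases Multiset.mem_cons.mp ha with rfl | ha
      · simp
      · exact ⟨(h a ha).1, by linarith [(h a ha).2]⟩

/-- All balls to be processed have delay `t`. This always holds during iteration `t`, because the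
balls with smaller delay were used up before. -/
def IterState.PendingDelay (t : ℕ) (x : IterState) : Prop := ∀ b ∈ x.pending, b.delay = t

/-- With all pending delays equal to `t`, the descendants of a processed ball wait for the next
iteration. -/
theorem processBall_iff {t : ℕ} {x y : IterState} (hx : x.PendingDelay t) :
    ProcessBall t x y ↔ ∃ (b : Ball) (D : Multiset Ball), x.pending = b ::ₘ D ∧ b.pos ≤ x.wall ∧
      y = ⟨D, x.next + descendants b x.wall, x.wall + 1⟩ := by
  constructor
  · rintro ⟨b, D, N, w, legal⟩
    have hb : ¬ b.delay + 1 ≤ t := by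
      have := hx b (Multiset.mem_cons_self b D)
      lia
    exact ⟨b, D, rfl, legal, by simp [hb]⟩
  · obtain ⟨P, N, w⟩ := x
    rintro ⟨b, D, rfl, legal, rfl⟩
    have hb : ¬ b.delay + 1 ≤ t := by
      have := hx b (Multiset.mem_cons_self b D)
      lia
    simpa [hb] using ProcessBall.process (t := t) b D N w legal

theorem ProcessBall.pendingDelay {t : ℕ} {x y : IterState} (h : ProcessBall t x y)
    (hx : x.PendingDelay t) : y.PendingDelay t := by
  obtain ⟨b, D, hD, -, rfl⟩ := (processBall_iff hx).mp h
  exact fun a ha => hx a (hD ▸ Multiset.mem_cons_of_mem ha)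

/-- The diamond property: two legal balls can be processed in either order, and both orders give
the same descendants. -/
theorem ProcessBall.diamond {t : ℕ} {x y z : IterState} (hx : x.PendingDelay t)
    (hy : ProcessBall t x y) (hz : ProcessBall t x z) :
    y = z ∨ ∃ u, ProcessBall t y u ∧ ProcessBall t z u := by
  have hy' := hy.pendingDelay hx
  have hz' := hz.pendingDelay hx
  obtain ⟨b, D, hD, hb, rfl⟩ := (processBall_iff hx).mp hy
  obtain ⟨c, F, hF, hc, rfl⟩ := (processBall_iff hx).mp hz
  have hbt : b.delay = t := hx b (hD ▸ Multiset.mem_cons_self b D)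
  have hct : c.delay = t := hx c (hF ▸ Multiset.mem_cons_self c F)
  rcases Multiset.cons_eq_cons.mp (hD.symm.trans hF) with ⟨rfl, rfl⟩ | ⟨-, G, rfl, rfl⟩
  · exact Or.inl rfl
  · refine Or.inr ⟨⟨G, x.next + descendants b x.wall + descendants c (x.wall + 1),
      x.wall + 1 + 1⟩, (processBall_iff hy').mpr ⟨c, G, rfl, by simp only; lia, rfl⟩,
      (processBall_iff hz').mpr ⟨b, G, rfl, by simp only; lia, ?_⟩⟩
    rw [descendants_add_one hb, descendants_add_one hc, hbt, hct]
    simp only [Multiset.add_cons, add_right_comm]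

/-- If one order of processing empties the set of pending balls, every order leads to the same
final state. -/
theorem reflTransGen_of_complete {t : ℕ} {x y z : IterState} (hx : x.PendingDelay t)
    (hy : Relation.ReflTransGen (ProcessBall t) x y)
    (hz : Relation.ReflTransGen (ProcessBall t) x z) (h0 : z.pending = 0) :
    Relation.ReflTransGen (ProcessBall t) y z := by
  have key : ∀ {u : IterState}, Relation.ReflTransGen (ProcessBall t) x u →
      Relation.ReflTransGen (fun a b => a.PendingDelay t ∧ ProcessBall t a b) x u ∧
        u.PendingDelay t := by
    intro u hu
    induction hu with
    | refl => exact ⟨.refl, hx⟩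
    | tail _ h ih => exact ⟨ih.1.tail ⟨ih.2, h⟩, h.pendingDelay ih.2⟩
  obtain ⟨u, hyu, hzu⟩ := Relation.church_rosser (fun a b c hab hac => by
    rcases ProcessBall.diamond hab.1 hab.2 hac.2 with rfl | ⟨d, hbd, hcd⟩
    · exact ⟨b, .refl, .refl⟩
    · exact ⟨d, .single ⟨hab.2.pendingDelay hab.1, hbd⟩,
        .single ⟨hac.2.pendingDelay hab.1, hcd⟩⟩) (key hy).1 (key hz).1
  rcases Relation.ReflTransGen.cases_head hzu with rfl | ⟨v, hv, -⟩
  · exact hyu.lift id fun _ _ h => h.2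
  · obtain ⟨b, D, hD, -⟩ := (processBall_iff hv.1).mp hv.2
    simp [h0] at hD

/-! ### Running an iteration with additional balls -/

theorem ProcessBall.wall_le {t : ℕ} {x z : IterState}
    (h : Relation.ReflTransGen (ProcessBall t) x z) : x.wall ≤ z.wall := by
  induction h with
  | refl => exact le_rfl
  | tail _ h ih => cases h; simp only at ih ⊢; lia

/-- A run survives when pending balls `P` and waiting balls `N` are added and the wall is moved to
the right: the same balls are processed, and each of them gets some extra descendants. -/
theorem exists_run_frame {t : ℕ} {x z : IterState}
    (h : Relation.ReflTransGen (ProcessBall t) x z) (hx : x.PendingDelay t) (hz : z.pending = 0)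
    {P : Multiset Ball} (hP : ∀ b ∈ P, b.delay = t) (N : Multiset Ball) {v : ℤ}
    (hv : x.wall ≤ v) :
    ∃ X : Multiset Ball, (∀ b ∈ X, b.delay = t + 1 ∧ b.pos < z.wall + (v - x.wall)) ∧
      Relation.ReflTransGen (ProcessBall t) ⟨x.pending + P, x.next + N, v⟩
        ⟨P, z.next + N + X, z.wall + (v - x.wall)⟩ := by
  induction h using Relation.ReflTransGen.head_induction_on generalizing N v with
  | refl => exact ⟨0, by simp, by simpa [hz] using .refl⟩
  | @head x y hxy hyz ih =>
    have hy := hxy.pendingDelay hx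
    have hwall := ProcessBall.wall_le hyz
    obtain ⟨b, D, hD, hb, rfl⟩ := (processBall_iff hx).mp hxy
    obtain ⟨Y, hY, hYb⟩ := descendants_of_le hb hv
    obtain ⟨X, hX, hrun⟩ := ih hy (N + Y) (v := v + 1) (by simpa using hv)
    have hbt : b.delay = t := hx b (hD ▸ Multiset.mem_cons_self b D)
    have hw : z.wall + (v + 1 - (x.wall + 1)) = z.wall + (v - x.wall) := by ring
    simp only [hw] at hX hrun hwall
    refine ⟨Y + X, ?_, ?_⟩
    · intro a ha
      rcases Multiset.mem_add.mp ha with ha | ha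
      · have := hYb a ha
        exact ⟨by lia, by lia⟩
      · exact hX a ha
    · refine .head ((processBall_iff ?_).mpr ⟨b, D + P, ?_, ?_, rfl⟩) ?_
      · intro a ha
        rcases Multiset.mem_add.mp ha with ha | ha
        · exact hx a ha
        · exact hP a ha
      · simp only [hD, Multiset.cons_add]
      · exact hb.trans hv
      · convert hrun using 2
        · simp only [hY]; abel
        · abel

/-- Balls that are all legal at the start can be processed in any order. -/
theorem exists_run_of_legal {t : ℕ} {P : Multiset Ball} (hP : ∀ b ∈ P, b.delay = t) {w : ℤ}
    (legal : ∀ b ∈ P, b.pos ≤ w) (N : Multiset Ball) :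
    ∃ X : Multiset Ball, (∀ b ∈ X, b.delay = t + 1 ∧ b.pos < w + P.card) ∧
      Relation.ReflTransGen (ProcessBall t) ⟨P, N, w⟩ ⟨0, N + X, w + P.card⟩ := by
  induction P using Multiset.induction_on generalizing N w with
  | empty => exact ⟨0, by simp, by simpa using .refl⟩
  | cons b P ih =>
    have hb := legal b (Multiset.mem_cons_self b P)
    have hbt := hP b (Multiset.mem_cons_self b P)
    obtain ⟨X, hX, hrun⟩ := ih (fun a ha => hP a (Multiset.mem_cons_of_mem ha)) (w := w + 1)
      (fun a ha => by linarith [legal a (Multiset.mem_cons_of_mem ha)]) (N + descendants b w)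
    have hw : w + 1 + (P.card : ℤ) = w + ((b ::ₘ P).card : ℕ) := by
      rw [Multiset.card_cons]; push_cast; ring
    rw [hw] at hX hrun
    refine ⟨descendants b w + X, ?_, ?_⟩
    · intro a ha
      rcases Multiset.mem_add.mp ha with ha | ha
      · have := mem_descendants.mp ha
        rw [Multiset.card_cons]
        push_cast
        exact ⟨by lia, by lia⟩
      · exact hX a ha
    · refine .head ((processBall_iff (x := ⟨b ::ₘ P, N, w⟩) hP).mpr ⟨b, P, rfl, hb, rfl⟩) ?_
      simpa [add_assoc] using hrun

/-! ### Outputs of the process -/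

theorem startIteration_pendingDelay {t : ℕ} {c : BallsWall} (hc : ∀ b ∈ c.balls, (t : ℤ) ≤ b.delay) :
    (startIteration t c).PendingDelay t := fun b hb => by
  have h := Multiset.mem_filter.mp hb
  exact le_antisymm h.2 (hc b h.1)

theorem reflTransGen_le_delay {t : ℕ} {x z : IterState}
    (h : Relation.ReflTransGen (ProcessBall t) x z) (hx : x.PendingDelay t)
    (hN : ∀ b ∈ x.next, (t : ℤ) + 1 ≤ b.delay) : ∀ b ∈ z.next, (t : ℤ) + 1 ≤ b.delay := by
  induction h using Relation.ReflTransGen.head_induction_on with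
  | refl => exact hN
  | @head x y hxy _ ih =>
    refine ih (hxy.pendingDelay hx) ?_
    obtain ⟨b, D, hD, hb, rfl⟩ := (processBall_iff hx).mp hxy
    intro a ha
    rcases Multiset.mem_add.mp ha with ha | ha
    · exact hN a ha
    · have := (mem_descendants.mp ha).2
      have := hx b (hD ▸ Multiset.mem_cons_self b D)
      lia

theorem Iteration.le_delay {t : ℕ} {c c' : BallsWall} (h : Iteration t c c')
    (hc : ∀ b ∈ c.balls, (t : ℤ) ≤ b.delay) : ∀ b ∈ c'.balls, (t : ℤ) + 1 ≤ b.delay :=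
  reflTransGen_le_delay h (startIteration_pendingDelay hc) fun b hb => by
    have h := (Multiset.mem_filter.mp hb).2
    lia

theorem Iteration.eq_of_le_delay {t : ℕ} {c c₁ c₂ : BallsWall} (h₁ : Iteration t c c₁)
    (h₂ : Iteration t c c₂) (hc : ∀ b ∈ c.balls, (t : ℤ) ≤ b.delay) : c₁ = c₂ := by
  have h := reflTransGen_of_complete (startIteration_pendingDelay hc) h₁ h₂ rfl
  rcases Relation.ReflTransGen.cases_head h with h | ⟨v, hv, -⟩
  · simp only [IterState.mk.injEq, true_and] at h
    exact BallsWall.ext h.1 h.2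
  · obtain ⟨b, D, hD, -⟩ := (processBall_iff (fun a ha => by simp at ha)).mp hv
    simp at hD

theorem IsOutput.le_delay {c₀ : BallsWall} {out : ℕ → BallsWall} (h : IsOutput c₀ out)
    (h₀ : ∀ b ∈ c₀.balls, 0 ≤ b.delay) (t : ℕ) : ∀ b ∈ (out t).balls, (t : ℤ) ≤ b.delay := by
  induction t with
  | zero => simpa [h.1] using h₀
  | succ t ih => exact_mod_cast (h.2 t).le_delay ih

theorem IsOutput.eq_of_reachedAt {c₀ : BallsWall} {out : ℕ → BallsWall} (h : IsOutput c₀ out)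
    (h₀ : ∀ b ∈ c₀.balls, 0 ≤ b.delay) {t : ℕ} {c : BallsWall} (hc : ReachedAt c₀ t c) :
    c = out t := by
  induction hc with
  | start => exact h.1.symm
  | @step t c c' _ hcc' ih =>
    subst ih
    exact hcc'.eq_of_le_delay (h.2 t) (h.le_delay h₀ t)

theorem IsOutput.unique {c₀ : BallsWall} {out out' : ℕ → BallsWall} (h : IsOutput c₀ out)
    (h' : IsOutput c₀ out') (h₀ : ∀ b ∈ c₀.balls, 0 ≤ b.delay) : out' = out := by
  have hr : ∀ t, ReachedAt c₀ t (out' t) := by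
    intro t
    induction t with
    | zero => exact h'.1 ▸ .start
    | succ t ih => exact ih.step (h'.2 t)
  exact funext fun t => h.eq_of_reachedAt h₀ (hr t)

theorem IsOutput.not_canTerminateAbruptly {c₀ : BallsWall} {out : ℕ → BallsWall}
    (h : IsOutput c₀ out) (h₀ : ∀ b ∈ c₀.balls, 0 ≤ b.delay) : ¬ CanTerminateAbruptly c₀ := by
  rintro ⟨t, c, x, hc, hx, hne, hstuck⟩
  obtain rfl := h.eq_of_reachedAt h₀ hc
  have hd := startIteration_pendingDelay (h.le_delay h₀ t)
  have hrun := reflTransGen_of_complete hd hx (h.2 t) rfl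
  rcases Relation.ReflTransGen.cases_head hrun with rfl | ⟨v, hv, -⟩
  · exact hne rfl
  · cases hv with
    | process b D N w legal => exact hstuck b (Multiset.mem_cons_self b D) legal

theorem IsOutput.wall_mono {c₀ : BallsWall} {out : ℕ → BallsWall} (h : IsOutput c₀ out) :
    Monotone fun t => (out t).wall :=
  monotone_nat_of_le_succ fun t => ProcessBall.wall_le (h.2 t)

/-- Balls `b` whose position is at most the position of the wall at the end of iteration `b.delay`
can be added to the initial configuration of a process that does not get stuck. The new process
does not get stuck either, and each added ball moves the wall by at least one. -/
theorem IsOutput.exists_add {M E : Multiset Ball} {w₀ : ℤ} {out : ℕ → BallsWall}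
    (h : IsOutput ⟨M, w₀⟩ out) (hM : ∀ b ∈ M, 0 ≤ b.delay)
    (hE : ∀ b ∈ E, 0 ≤ b.delay ∧ b.pos ≤ (out (b.delay.toNat + 1)).wall) :
    ∃ out', IsOutput ⟨M + E, w₀⟩ out' ∧
      ∀ t : ℕ, (out t).wall + (E.filter fun b => b.delay < (t : ℤ)).card ≤ (out' t).wall := by
  -- The new configuration `d` at time `t` consists of the old one and extra balls `X`, which stay
  -- legal relative to the old process once the displacement of the wall is taken into account.
  let Sim (t : ℕ) (d : BallsWall) : Prop := ∃ X : Multiset Ball, d.balls = (out t).balls + X ∧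
    E.filter (fun b => (t : ℤ) ≤ b.delay) ≤ X ∧
    (out t).wall + (E.filter fun b => b.delay < (t : ℤ)).card ≤ d.wall ∧
    ∀ b ∈ X, (t : ℤ) ≤ b.delay ∧
      b.pos ≤ (out (b.delay.toNat + 1)).wall + (d.wall - (out t).wall)
  have step : ∀ (t : ℕ) (d : BallsWall), Sim t d → ∃ d', Iteration t d d' ∧ Sim (t + 1) d' := by
    rintro t ⟨B, v⟩ ⟨X, rfl, hEX, hwall, hX⟩
    have hpend := startIteration_pendingDelay (h.le_delay hM t)
    have hP : ∀ b ∈ X.filter (fun b => b.delay ≤ (t : ℤ)), b.delay = t := fun b hb =>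
      le_antisymm (Multiset.mem_filter.mp hb).2 (hX b (Multiset.mem_filter.mp hb).1).1
    simp only at hwall hX
    obtain ⟨Y, hY, hrun⟩ := exists_run_frame (h.2 t) hpend rfl hP
      (X.filter fun b => ¬ b.delay ≤ (t : ℤ)) (v := v)
      (by simp only [startIteration]; lia)
    obtain ⟨Z, hZ, hrun'⟩ := exists_run_of_legal hP
      (w := (out (t + 1)).wall + (v - (out t).wall)) (fun b hb => by
        have := (hX b (Multiset.mem_filter.mp hb).1).2
        rwa [hP b hb, Int.toNat_natCast] at this)
      ((out (t + 1)).balls + (X.filter fun b => ¬ b.delay ≤ (t : ℤ)) + Y)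
    simp only [startIteration] at hY hrun
    have hnext : (out (t + 1)).wall ≤ (out (t + 1 + 1)).wall := h.wall_mono (Nat.le_succ (t + 1))
    refine ⟨⟨(out (t + 1)).balls + (X.filter fun b => ¬ b.delay ≤ (t : ℤ)) + Y + Z,
      (out (t + 1)).wall + (v - (out t).wall) + (X.filter fun b => b.delay ≤ (t : ℤ)).card⟩, ?_,
      (X.filter fun b => ¬ b.delay ≤ (t : ℤ)) + Y + Z, by simp only; abel, ?_, ?_, ?_⟩
    · rw [Iteration, startIteration]
      simp only [Multiset.filter_add]
      exact hrun.trans hrun'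
    · refine le_trans ?_ (Multiset.le_add_right _ Z)
      refine le_trans ?_ (Multiset.le_add_right _ Y)
      refine le_trans (le_of_eq ?_) (Multiset.filter_le_filter _ hEX)
      rw [Multiset.filter_filter]
      refine Multiset.filter_congr fun b _ => ?_
      push_cast
      lia
    · have h1 := Multiset.card_le_card (Multiset.filter_le_filter (fun b => b.delay ≤ (t : ℤ)) hEX)
      have h2 : (E.filter fun b => b.delay < ((t + 1 : ℕ) : ℤ)).card =
          (E.filter fun b => b.delay < (t : ℤ)).card +
            ((E.filter fun b => (t : ℤ) ≤ b.delay).filter fun b => b.delay ≤ (t : ℤ)).card := by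
        rw [← Multiset.card_add, Multiset.filter_filter,
          ← Multiset.filter_add_not (fun b => b.delay < (t : ℤ))
            (E.filter fun b => b.delay < ((t + 1 : ℕ) : ℤ)), Multiset.filter_filter,
          Multiset.filter_filter]
        congr 2
        · refine Multiset.filter_congr fun b _ => ?_
          push_cast
          lia
        · refine Multiset.filter_congr fun b _ => ?_
          push_cast
          lia
      simp only
      lia
    · intro b hb
      simp only
      rcases Multiset.mem_add.mp hb with hb | hb
      · rcases Multiset.mem_add.mp hb with hb | hb
        · obtain ⟨hb, hbt⟩ := Multiset.mem_filter.mp hb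
          have := hX b hb
          exact ⟨by lia, by lia⟩
        · obtain ⟨hbt, hpos⟩ := hY b hb
          have : b.delay.toNat = t + 1 := by lia
          rw [this]
          exact ⟨by lia, by lia⟩
      · obtain ⟨hbt, hpos⟩ := hZ b hb
        have : b.delay.toNat = t + 1 := by lia
        rw [this]
        exact ⟨by lia, by lia⟩
  choose! f hf hSim using step
  let out' : ℕ → BallsWall := fun t => Nat.rec ⟨M + E, w₀⟩ f t
  have hall : ∀ t, Sim t (out' t) := by
    intro t
    induction t with
    | zero =>
      refine ⟨E, by simp [out', h.1], Multiset.filter_le _ _, ?_, ?_⟩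
      · rw [Multiset.filter_eq_nil.mpr fun b hb => by have := (hE b hb).1; simpa using this]
        simp [out', h.1]
      · intro b hb
        simpa [out', h.1] using hE b hb
    | succ t ih => exact hSim t _ ih
  refine ⟨out', ⟨rfl, fun t => hf t _ (hall t)⟩, fun t => ?_⟩
  obtain ⟨-, -, -, hw, -⟩ := hall t
  exact hw

/-! ### Leaves of the tree of an edge -/

theorem leafLabels_of_find?_eq_none {n : ℕ} {B : List (Finset (Fin n))} {Lv Le : Finset (Fin n)}
    (h : B.find? (fun s => decide (Disjoint s Le)) = none) : leafLabels B Lv Le = 0 := by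
  rw [leafLabels, h]

theorem leafLabels_of_find?_eq_some {n : ℕ} {B : List (Finset (Fin n))}
    {Lv Le r : Finset (Fin n)} (h : B.find? (fun s => decide (Disjoint s Le)) = some r) :
    leafLabels B Lv Le = (Lv ∪ r, Le) ::ₘ
      ∑ s ∈ (r \ Lv).powerset.erase ∅, leafLabels B (Lv ∪ r) (Le ∪ s) := by
  rw [leafLabels, h, ← Finset.sum_attach ((r \ Lv).powerset.erase ∅)]

theorem mem_leafLabels_of_find?_eq_some {n : ℕ} {B : List (Finset (Fin n))}
    {Lv Le r : Finset (Fin n)} (h : B.find? (fun s => decide (Disjoint s Le)) = some r)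
    {p : Finset (Fin n) × Finset (Fin n)} :
    p ∈ leafLabels B Lv Le ↔ p = (Lv ∪ r, Le) ∨
      ∃ s : Finset (Fin n), (s.Nonempty ∧ s ⊆ r \ Lv) ∧ p ∈ leafLabels B (Lv ∪ r) (Le ∪ s) := by
  rw [leafLabels_of_find?_eq_some h, Multiset.mem_cons, Multiset.mem_sum]
  simp only [Finset.mem_erase, Finset.mem_powerset, Finset.nonempty_iff_ne_empty]

theorem mem_and_disjoint_of_find?_eq_some {n : ℕ} {B : List (Finset (Fin n))}
    {Le r : Finset (Fin n)} (h : B.find? (fun s => decide (Disjoint s Le)) = some r) :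
    r ∈ B ∧ Disjoint r Le :=
  ⟨List.mem_of_find?_eq_some h, by simpa using List.find?_some h⟩

/-- Induction over the subtrees of the tree built from `B`. -/
theorem leafLabels_induction {n : ℕ} {B : List (Finset (Fin n))}
    {motive : Finset (Fin n) → Finset (Fin n) → Prop}
    (none : ∀ Lv Le, B.find? (fun s => decide (Disjoint s Le)) = none → motive Lv Le)
    (some : ∀ Lv Le r, B.find? (fun s => decide (Disjoint s Le)) = some r →
      (∀ s : Finset (Fin n), s.Nonempty → s ⊆ r \ Lv → motive (Lv ∪ r) (Le ∪ s)) → motive Lv Le)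
    (Lv Le : Finset (Fin n)) : motive Lv Le := by
  induction Lv, Le using leafLabels.induct B with
  | case1 Lv Le h => exact none Lv Le h
  | case2 Lv Le r h ih =>
    exact some Lv Le r h fun s hs hsr => ih ⟨s, Finset.mem_erase.mpr
      ⟨hs.ne_empty, Finset.mem_powerset.mpr hsr⟩⟩

/-- The sets to which the vertices of a path belong are distinct, since each of them meets the
edge label below it and the later ones avoid that label. So a path to a leaf with `|ℓ_e| = d`
involves at most `d + 1` sets. -/
theorem exists_sets_of_mem_leafLabels {n : ℕ} {B : List (Finset (Fin n))}
    {Lv Le : Finset (Fin n)} {p : Finset (Fin n) × Finset (Fin n)} (hL : Le ⊆ Lv)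
    (hp : p ∈ leafLabels B Lv Le) :
    ∃ R : Finset (Finset (Fin n)), R.Nonempty ∧ (∀ r ∈ R, r ∈ B ∧ Disjoint r Le) ∧
      p.1 = Lv ∪ R.biUnion id ∧ Le ⊆ p.2 ∧ p.2 ⊆ p.1 ∧ R.card + Le.card ≤ p.2.card + 1 := by
  induction Lv, Le using leafLabels_induction (B := B) with
  | none Lv Le h => simp [leafLabels_of_find?_eq_none h] at hp
  | some Lv Le r h ih =>
    have hr := mem_and_disjoint_of_find?_eq_some h
    rcases (mem_leafLabels_of_find?_eq_some h).mp hp with rfl | ⟨s, ⟨hs, hsr⟩, hp⟩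
    · exact ⟨{r}, by simp, by simpa using hr, by simp, subset_rfl,
        hL.trans Finset.subset_union_left, by simp [add_comm]⟩
    · have hsr' : s ⊆ r := hsr.trans Finset.sdiff_subset
      obtain ⟨R, -, hR, h1, h2, h3, h4⟩ := ih s hs hsr
        (Finset.union_subset_union hL hsr') hp
      have hrR : r ∉ R := fun hrR => by
        obtain ⟨x, hx⟩ := hs
        exact Finset.disjoint_left.mp (hR r hrR).2 (hsr' hx) (Finset.mem_union_right _ hx)
      have hdisj : Disjoint Le s := (hr.2.mono_left hsr').symm
      refine ⟨insert r R, by simp, ?_, ?_, Finset.subset_union_left.trans h2, h3, ?_⟩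
      · intro r' hr'
        rcases Finset.mem_insert.mp hr' with rfl | hr'
        · exact hr
        · exact ⟨(hR r' hr').1, (hR r' hr').2.mono_right Finset.subset_union_left⟩
      · rw [h1, Finset.biUnion_insert, id, Finset.union_assoc]
      · rw [Finset.card_union_of_disjoint hdisj] at h4
        rw [Finset.card_insert_of_notMem hrR]
        have := hs.card_pos
        lia

/-- The decision path of the complement of `b` ends at a vertex that belongs to `b`. -/
theorem exists_mem_leafLabels_sdiff_eq {n : ℕ} {B : List (Finset (Fin n))}
    (hB : ∀ r ∈ B, ∀ b ∈ B, r ⊆ b → r = b) {b : Finset (Fin n)} (hb : b ∈ B)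
    {Lv Le : Finset (Fin n)} (hL : Le = Lv \ b) :
    ∃ p ∈ leafLabels B Lv Le, p.1 \ p.2 = b := by
  induction Lv, Le using leafLabels_induction (B := B) with
  | none Lv Le h =>
    have := List.find?_eq_none.mp h b hb
    simp [hL, Finset.disjoint_sdiff] at this
  | some Lv Le r h ih =>
    have hr := mem_and_disjoint_of_find?_eq_some h
    by_cases hrb : r \ Lv ⊆ b
    · have : r = b := hB r hr.1 b hb fun x hx => by
        by_contra hxb
        by_cases hxv : x ∈ Lv
        · exact Finset.disjoint_left.mp hr.2 hx (hL ▸ Finset.mem_sdiff.mpr ⟨hxv, hxb⟩)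
        · exact hxb (hrb (Finset.mem_sdiff.mpr ⟨hx, hxv⟩))
      subst this
      refine ⟨_, (mem_leafLabels_of_find?_eq_some h).mpr (Or.inl rfl), ?_⟩
      subst hL
      ext x
      simp only [Finset.mem_sdiff, Finset.mem_union]
      tauto
    · have hs : ((r \ Lv) \ b).Nonempty := Finset.sdiff_nonempty.mpr hrb
      obtain ⟨p, hp, hpb⟩ := ih _ hs Finset.sdiff_subset (by
        subst hL
        ext x
        simp only [Finset.mem_sdiff, Finset.mem_union]
        tauto)
      exact ⟨p, (mem_leafLabels_of_find?_eq_some h).mpr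
        (Or.inr ⟨_, ⟨hs, Finset.sdiff_subset⟩, hp⟩), hpb⟩

/-- The sizes of the edge labels of the leaves have no gaps: shrinking the label of a tree edge
only enlarges the choice of sets that are available below it. -/
theorem exists_mem_leafLabels_card_eq {n : ℕ} {B : List (Finset (Fin n))}
    {Lv Le : Finset (Fin n)} {p : Finset (Fin n) × Finset (Fin n)} (hL : Le ⊆ Lv)
    (hp : p ∈ leafLabels B Lv Le) {d : ℕ} (h₁ : Le.card ≤ d) (h₂ : d ≤ p.2.card) :
    ∃ q ∈ leafLabels B Lv Le, q.2.card = d := by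
  induction Lv, Le using leafLabels_induction (B := B) with
  | none Lv Le h => simp [leafLabels_of_find?_eq_none h] at hp
  | some Lv Le r h ih =>
    have hr := mem_and_disjoint_of_find?_eq_some h
    simp only [mem_leafLabels_of_find?_eq_some h]
    rcases h₁.eq_or_lt with rfl | hlt
    · exact ⟨_, Or.inl rfl, rfl⟩
    rcases (mem_leafLabels_of_find?_eq_some h).mp hp with rfl | ⟨s, ⟨hs, hsr⟩, hp⟩
    · exact absurd h₂ (not_le.mpr hlt)
    have hsr' : s ⊆ r := hsr.trans Finset.sdiff_subset
    have hL' : Le ∪ s ⊆ Lv ∪ r := Finset.union_subset_union hL hsr'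
    have hdisj : Disjoint Le s := (hr.2.mono_left hsr').symm
    rcases le_or_gt (Le ∪ s).card d with hd | hd
    · obtain ⟨q, hq, hqd⟩ := ih s hs hsr hL' hp hd
      exact ⟨q, Or.inr ⟨s, ⟨hs, hsr⟩, hq⟩, hqd⟩
    · rw [Finset.card_union_of_disjoint hdisj] at hd
      obtain ⟨s', hs', hcard⟩ := Finset.exists_subset_card_eq (show d - Le.card ≤ s.card by lia)
      have hne : s'.Nonempty := Finset.card_pos.mp (by lia)
      obtain ⟨R, ⟨b, hb⟩, hR, -⟩ := exists_sets_of_mem_leafLabels hL' hp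
      have hb := hR b hb
      -- A set of `B` that avoids `Le ∪ s` also avoids `Le ∪ s'`, so the child for `s'` exists.
      obtain ⟨r', hr'⟩ : ∃ r', B.find? (fun t => decide (Disjoint t (Le ∪ s'))) = some r' := by
        rw [← Option.isSome_iff_exists, List.find?_isSome]
        exact ⟨b, hb.1, by
          simpa using hb.2.mono_right (Finset.union_subset_union subset_rfl hs')⟩
      refine ⟨_, Or.inr ⟨s', ⟨hne, hs'.trans hsr⟩,
        (mem_leafLabels_of_find?_eq_some hr').mpr (Or.inl rfl)⟩, ?_⟩
      simp only
      rw [Finset.card_union_of_disjoint (hdisj.mono_right hs'), hcard]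
      lia

/-- If `B` is an antichain with at least `c` members, then its tree has at least `c` leaves with
`|ℓ_e| < c`. Either each of the sizes `0, …, c - 1` occurs, or all sizes are less than `c` and
there is a leaf for every member of `B`. -/
theorem le_card_filter_treeLeafLabels {n : ℕ} {B : List (Finset (Fin n))}
    (hB : ∀ r ∈ B, ∀ b ∈ B, r ⊆ b → r = b) {C : Finset (Finset (Fin n))} (hC : ∀ b ∈ C, b ∈ B) :
    C.card ≤ ((treeLeafLabels B).filter fun p => p.2.card < C.card).card := by
  classical
  by_cases h : ∃ p ∈ treeLeafLabels B, C.card ≤ p.2.card + 1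
  · obtain ⟨p, hp, hpc⟩ := h
    have hsub : Finset.range C.card ⊆
        (((treeLeafLabels B).filter fun p => p.2.card < C.card).map fun p => p.2.card).toFinset := by
      intro d hd
      have hd := Finset.mem_range.mp hd
      obtain ⟨q, hq, hqd⟩ := exists_mem_leafLabels_card_eq (d := d) subset_rfl hp (by simp) (by lia)
      rw [Multiset.mem_toFinset, Multiset.mem_map]
      exact ⟨q, Multiset.mem_filter.mpr ⟨hq, by lia⟩, hqd⟩
    have := (Finset.card_le_card hsub).trans (Multiset.toFinset_card_le _)
    simpa using this
  · push Not at h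
    rw [Multiset.filter_eq_self.mpr fun p hp => by have := h p hp; lia]
    have hsub : C ⊆ ((treeLeafLabels B).map fun p => p.1 \ p.2).toFinset := by
      intro b hb
      rw [Multiset.mem_toFinset, Multiset.mem_map]
      exact exists_mem_leafLabels_sdiff_eq hB (hC b hb) (by simp)
    have := (Finset.card_le_card hsub).trans (Multiset.toFinset_card_le _)
    simpa using this

/-! ### Minimal transversals bound the position of the wall -/

/-- `s` is, under containment, a minimal set that meets every member of `prev`. -/
def IsMinimalTransversal {n : ℕ} (prev : List (Finset (Fin n))) (s : Finset (Fin n)) : Prop :=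
  Minimal (fun t : Finset (Fin n) => ∀ f ∈ prev, (t ∩ f).Nonempty) s

theorem isMinimalDominating_iff {n : ℕ} {prev : List (Finset (Fin n))} {e s : Finset (Fin n)} :
    IsMinimalDominating prev e s ↔ IsMinimalTransversal prev s ∧ Disjoint s e := by
  constructor
  · rintro ⟨⟨hd, h⟩, hmin⟩
    exact ⟨⟨h, fun t ht hts => hmin ⟨hd.mono_left hts, ht⟩ hts⟩, hd⟩
  · rintro ⟨⟨h, hmin⟩, hd⟩
    exact ⟨⟨hd, h⟩, fun t ht hts => hmin ht.2 hts⟩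

/-- If a minimal transversal `r` of `prev ++ [e]` is not minimal for `prev`, then `r` has a
single element in `e`, and removing it gives a minimal transversal of `prev`. -/
theorem IsMinimalTransversal.sdiff {n : ℕ} {prev : List (Finset (Fin n))} {e r : Finset (Fin n)}
    (h : IsMinimalTransversal (prev ++ [e]) r) (h' : ¬ IsMinimalTransversal prev r) :
    IsMinimalTransversal prev (r \ e) ∧ (r ∩ e).card ≤ 1 := by
  have hprev : ∀ f ∈ prev, (r ∩ f).Nonempty := fun f hf => h.prop f (by simp [hf])
  have hre : (r ∩ e).Nonempty := h.prop e (by simp)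
  have key : ∀ t : Finset (Fin n), (∀ f ∈ prev, (t ∩ f).Nonempty) → t ⊆ r → t ≠ r → t ∩ e = ∅ := by
    intro t ht htr hne
    by_contra hte
    refine hne (htr.antisymm (h.le_of_le (fun f hf => ?_) htr))
    rcases List.mem_append.mp hf with hf | hf
    · exact ht f hf
    · rw [List.mem_singleton.mp hf]
      exact Finset.nonempty_iff_ne_empty.mpr hte
  obtain ⟨s, hs, hsr, hrs⟩ : ∃ s : Finset (Fin n), (∀ f ∈ prev, (s ∩ f).Nonempty) ∧ s ⊆ r ∧
      ¬ r ⊆ s := by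
    by_contra hcon
    push Not at hcon
    exact h' ⟨hprev, fun t ht htr => hcon t ht htr⟩
  have herase : ∀ (t : Finset (Fin n)) (y : Fin n), (∀ f ∈ prev, (t ∩ f).Nonempty) → t ⊆ r →
      y ∈ r → y ∉ t → r.erase y ∩ e = ∅ := by
    intro t y ht htr hyr hyt
    refine key _ (fun f hf => (ht f hf).mono ?_) (Finset.erase_subset y r)
      (Finset.erase_ne_self.mpr hyr)
    refine Finset.inter_subset_inter_right fun x hx => Finset.mem_erase.mpr ⟨?_, htr hx⟩
    rintro rfl
    exact hyt hx
  obtain ⟨y, hyr, hys⟩ := Finset.not_subset.mp hrs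
  have hy := herase s y hs hsr hyr hys
  have hsub : r ∩ e ⊆ {y} := by
    intro x hx
    by_contra hxy
    have hx' := Finset.mem_inter.mp hx
    exact Finset.notMem_empty x (hy ▸ Finset.mem_inter.mpr
      ⟨Finset.mem_erase.mpr ⟨by simpa using hxy, hx'.1⟩, hx'.2⟩)
  have hye : y ∈ e := by
    obtain ⟨x, hx⟩ := hre
    exact Finset.mem_singleton.mp (hsub hx) ▸ (Finset.mem_inter.mp hx).2
  refine ⟨⟨fun f hf => (hs f hf).mono ?_, fun t ht htr => ?_⟩,
    (Finset.card_le_card hsub).trans_eq (Finset.card_singleton y)⟩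
  · refine Finset.inter_subset_inter_right fun x hx => Finset.mem_sdiff.mpr ⟨hsr hx, fun hxe => ?_⟩
    have : x = y := Finset.mem_singleton.mp (hsub (Finset.mem_inter.mpr ⟨hsr hx, hxe⟩))
    exact hys (this ▸ hx)
  · intro z hz
    by_contra hzt
    have hz := Finset.mem_sdiff.mp hz
    have hz' := herase t z ht (htr.trans Finset.sdiff_subset) hz.1 hzt
    refine Finset.notMem_empty y (hz' ▸ Finset.mem_inter.mpr ⟨Finset.mem_erase.mpr ⟨?_, hyr⟩, hye⟩)
    rintro rfl
    exact hz.2 hye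

/-- The invariant that keeps all balls legal: `q` distinct minimal transversals of edges of size at
most `T` cover at most `w + q - 1` vertices, where `w` is the position of the wall at the end of
iteration `T + q - 1`. -/
def WallBound {n : ℕ} (prev : List (Finset (Fin n))) (out : ℕ → BallsWall) : Prop :=
  ∀ R : Finset (Finset (Fin n)), R.Nonempty → (∀ r ∈ R, IsMinimalTransversal prev r) →
    ∀ T : ℕ, (∀ e ∈ prev, e.card ≤ T) →
      ((R.biUnion id).card : ℤ) + 1 ≤ (out (T + R.card)).wall + R.card

/-- A leaf with `|ℓ_e| = d` comes from at most `d + 1` minimal transversals, whose union is `ℓ_v`;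
so its ball is legal. -/
theorem WallBound.leafBall_pos_le {n : ℕ} {prev B : List (Finset (Fin n))} {e : Finset (Fin n)}
    {out : ℕ → BallsWall} (h : WallBound prev out) (hmono : Monotone fun t => (out t).wall)
    (hB : ∀ s ∈ B, IsMinimalDominating prev e s) (hsize : ∀ f ∈ prev, f.card ≤ e.card)
    {p : Finset (Fin n) × Finset (Fin n)} (hp : p ∈ treeLeafLabels B) :
    (leafBall e p).pos ≤ (out ((leafBall e p).delay.toNat + 1)).wall := by
  obtain ⟨R, hR, hRB, h1, -, -, h4⟩ := exists_sets_of_mem_leafLabels subset_rfl hp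
  have hb := h R hR (fun r hr => (isMinimalDominating_iff.mp (hB r (hRB r hr).1)).1) e.card hsize
  rw [Finset.empty_union] at h1
  rw [Finset.card_empty, add_zero] at h4
  have hdelay : (leafBall e p).delay.toNat = e.card + p.2.card := by simp [leafBall]; lia
  have hw : (out (e.card + R.card)).wall ≤ (out (e.card + p.2.card + 1)).wall :=
    hmono (by lia)
  rw [hdelay]
  simp only [leafBall, h1]
  lia

/-- Removing the last edge `e` from the transversals turns the `a` of them that are not minimal
for `prev` into `c ≤ a` members of the list `B` of `e`, removing at most `a` vertices. Since the
number of transversals drops by `a - c`, a gain of `c` in the position of the wall suffices, and it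
comes from the `c` balls of small delay in the tree of `e`. -/
theorem WallBound.append {n : ℕ} {prev B : List (Finset (Fin n))} {e : Finset (Fin n)}
    {out out' : ℕ → BallsWall} (h : WallBound prev out) (hmono : Monotone fun t => (out t).wall)
    (hB : ∀ s, s ∈ B ↔ IsMinimalDominating prev e s)
    (hout : ∀ t : ℕ, (out t).wall + (((treeLeafLabels B).map (leafBall e)).filter
      fun b => b.delay < (t : ℤ)).card ≤ (out' t).wall) :
    WallBound (prev ++ [e]) out' := by
  classical
  intro R hR hRmin T hT
  set P := R.filter fun r => ¬ IsMinimalTransversal prev r with hP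
  set Q := R.filter fun r => IsMinimalTransversal prev r with hQ
  set P' := P.image fun r => r \ e with hP'
  have hPsdiff : ∀ r ∈ P, IsMinimalTransversal prev (r \ e) ∧ (r ∩ e).card ≤ 1 := fun r hr =>
    (hRmin r (Finset.mem_filter.mp hr).1).sdiff (Finset.mem_filter.mp hr).2
  have hP'B : ∀ b ∈ P', b ∈ B := by
    intro b hb
    obtain ⟨r, hr, rfl⟩ := Finset.mem_image.mp hb
    exact (hB _).mpr (isMinimalDominating_iff.mpr ⟨(hPsdiff r hr).1, Finset.sdiff_disjoint⟩)
  have hdisj : Disjoint Q P' := by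
    rw [Finset.disjoint_left]
    intro b hbQ hb
    have h1 := (hRmin b (Finset.mem_filter.mp hbQ).1).prop e (by simp)
    have h2 := (isMinimalDominating_iff.mp ((hB b).mp (hP'B b hb))).2
    exact Finset.nonempty_iff_ne_empty.mp h1 (Finset.disjoint_iff_inter_eq_empty.mp h2)
  have hcardR : Q.card + P.card = R.card := Finset.card_filter_add_card_filter_not _
  have hcardP' : P'.card ≤ P.card := Finset.card_image_le
  have hne : (Q ∪ P').Nonempty := by
    obtain ⟨r, hr⟩ := hR
    by_cases hrm : IsMinimalTransversal prev r
    · exact ⟨r, Finset.mem_union_left _ (Finset.mem_filter.mpr ⟨hr, hrm⟩)⟩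
    · exact ⟨r \ e, Finset.mem_union_right _
        (Finset.mem_image_of_mem _ (Finset.mem_filter.mpr ⟨hr, hrm⟩))⟩
  have hbound := h (Q ∪ P') hne (fun r hr => by
    rcases Finset.mem_union.mp hr with hr | hr
    · exact (Finset.mem_filter.mp hr).2
    · exact (isMinimalDominating_iff.mp ((hB r).mp (hP'B r hr))).1) T
    fun f hf => hT f (by simp [hf])
  rw [Finset.card_union_of_disjoint hdisj] at hbound
  have hunion : (R.biUnion id).card ≤ ((Q ∪ P').biUnion id).card + P.card := by
    have hsub : R.biUnion id ⊆ (Q ∪ P').biUnion id ∪ P.biUnion fun r => r ∩ e := by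
      intro x hx
      obtain ⟨r, hr, hxr⟩ := Finset.mem_biUnion.mp hx
      simp only [id] at hxr
      by_cases hrm : IsMinimalTransversal prev r
      · exact Finset.mem_union_left _ (Finset.mem_biUnion.mpr
          ⟨r, Finset.mem_union_left _ (Finset.mem_filter.mpr ⟨hr, hrm⟩), hxr⟩)
      · have hrP : r ∈ P := Finset.mem_filter.mpr ⟨hr, hrm⟩
        by_cases hxe : x ∈ e
        · exact Finset.mem_union_right _ (Finset.mem_biUnion.mpr
            ⟨r, hrP, Finset.mem_inter.mpr ⟨hxr, hxe⟩⟩)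
        · exact Finset.mem_union_left _ (Finset.mem_biUnion.mpr ⟨r \ e, Finset.mem_union_right _
            (Finset.mem_image_of_mem _ hrP), Finset.mem_sdiff.mpr ⟨hxr, hxe⟩⟩)
    refine (Finset.card_le_card hsub).trans ((Finset.card_union_le _ _).trans ?_)
    gcongr
    simpa using Finset.card_biUnion_le_card_mul P (fun r => r ∩ e) 1 fun r hr => (hPsdiff r hr).2
  have hgain : P'.card ≤ (((treeLeafLabels B).map (leafBall e)).filter
      fun b => b.delay < ((T + R.card : ℕ) : ℤ)).card := by
    refine (le_card_filter_treeLeafLabels (fun r hr b hb hrb => ?_) hP'B).trans ?_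
    · exact hrb.antisymm (((isMinimalDominating_iff.mp ((hB b).mp hb)).1).le_of_le
        ((isMinimalDominating_iff.mp ((hB r).mp hr)).1).prop hrb)
    · rw [Multiset.filter_map, Multiset.card_map]
      refine Multiset.card_le_card (Multiset.monotone_filter_right _ fun p hp => ?_)
      have he : e.card ≤ T := hT e (by simp)
      simp only [Function.comp, leafBall]
      push_cast
      lia
  have hw := hout (T + R.card)
  have hm : (out (T + (Q.card + P'.card))).wall ≤ (out (T + R.card)).wall := hmono (by lia)
  lia

/-! ### The process of a family of `k`-sets does not get stuck -/

theorem IsHypergraphEdge.card_pos {n k : ℕ} {S : Finset (Finset (Fin n))} {e : Finset (Fin n)}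
    (h : IsHypergraphEdge k S e) : 1 ≤ e.card := h.prop.1

theorem OrderedHypergraph.card_get_pos {n k : ℕ} {S : Finset (Finset (Fin n))}
    (H : OrderedHypergraph k S) (j : Fin H.edges.length) : 1 ≤ (H.edges.get j).card :=
  ((H.mem_edges _).mp (List.get_mem _ _)).card_pos

theorem OrderedHypergraph.one_le_delay {n k : ℕ} {S : Finset (Finset (Fin n))}
    (H : OrderedHypergraph k S) (s : Finset (Fin H.edges.length)) {b : Ball}
    (hb : b ∈ ∑ j ∈ s, (treeLeafLabels (H.dom j)).map (leafBall (H.edges.get j))) :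
    1 ≤ b.delay := by
  obtain ⟨j, -, hb⟩ := Multiset.mem_sum.mp hb
  obtain ⟨p, -, rfl⟩ := Multiset.mem_map.mp hb
  have := H.card_get_pos j
  simp only [leafBall]
  lia

theorem OrderedHypergraph.card_le_of_mem_take {n k : ℕ} {S : Finset (Finset (Fin n))}
    (H : OrderedHypergraph k S) (j : Fin H.edges.length) {f : Finset (Fin n)}
    (hf : f ∈ H.edges.take j) : f.card ≤ (H.edges.get j).card := by
  obtain ⟨i, hi, rfl⟩ := List.mem_iff_getElem.mp hf
  rw [List.getElem_take]
  have hij : i < j := by simp at hi; lia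
  exact List.pairwise_iff_getElem.mp H.comfortable i j (hij.trans j.2) j.2 hij

/-- The process can be completed for the balls of the first `m` edges. -/
theorem OrderedHypergraph.exists_isOutput_take {n k : ℕ} {S : Finset (Finset (Fin n))}
    (H : OrderedHypergraph k S) (m : ℕ) (hm : m ≤ H.edges.length) :
    ∃ out, IsOutput ⟨∑ j ∈ Finset.univ.filter (fun j : Fin H.edges.length => (j : ℕ) < m),
        (treeLeafLabels (H.dom j)).map (leafBall (H.edges.get j)), 0⟩ out ∧
      WallBound (H.edges.take m) out := by
  induction m with
  | zero =>
    refine ⟨fun _ => ⟨0, 0⟩, ⟨by simp, fun t => .refl⟩, fun R hR hRmin T _ => ?_⟩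
    have : R = {∅} := by
      refine hR.subset_singleton_iff.mp fun r hr => Finset.mem_singleton.mpr ?_
      exact Finset.subset_empty.mp ((hRmin r hr).le_of_le (by simp) (Finset.empty_subset r))
    simp [this]
  | succ m ih =>
    obtain ⟨out, hout, hW⟩ := ih (by lia)
    let j : Fin H.edges.length := ⟨m, hm⟩
    have hmono := hout.wall_mono
    obtain ⟨out', hout', hwall⟩ := hout.exists_add
      (E := (treeLeafLabels (H.dom j)).map (leafBall (H.edges.get j)))
      (fun b hb => by have := H.one_le_delay _ hb; lia) (by
        intro b hb
        obtain ⟨p, hp, rfl⟩ := Multiset.mem_map.mp hb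
        exact ⟨by simp only [leafBall]; lia, hW.leafBall_pos_le hmono
          (fun s => (H.mem_dom j s).mp) (fun f => H.card_le_of_mem_take j) hp⟩)
    refine ⟨out', ?_, ?_⟩
    · have : Finset.univ.filter (fun i : Fin H.edges.length => (i : ℕ) < m + 1) =
          insert j (Finset.univ.filter fun i : Fin H.edges.length => (i : ℕ) < m) := by
        ext i
        simp only [Finset.mem_filter, Finset.mem_univ, true_and, Finset.mem_insert, Fin.ext_iff, j]
        lia
      rw [this, Finset.sum_insert (by simp [j]), add_comm]
      exact hout'
    · have : H.edges.take (m + 1) = H.edges.take m ++ [H.edges.get j] := by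
        rw [List.take_add_one, List.getElem?_eq_getElem hm]
        rfl
      rw [this]
      exact hW.append hmono (H.mem_dom j) hwall

theorem OrderedHypergraph.exists_isOutput {n k : ℕ} {S : Finset (Finset (Fin n))}
    (H : OrderedHypergraph k S) : ∃ out, IsOutput (initialConfiguration H) out := by
  obtain ⟨out, hout, -⟩ := H.exists_isOutput_take H.edges.length le_rfl
  refine ⟨out, ?_⟩
  rwa [Finset.filter_true_of_mem fun j _ => j.2] at hout

/-! ### Pascal's rule and the invariant of the process -/

theorem intBinom_natCast (a b : ℕ) : intBinom a b = a.choose b := by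
  simp [intBinom, Ring.choose_natCast]

theorem intBinom_of_neg {x y : ℤ} (h : y < 0) : intBinom x y = 0 := if_neg (not_le.mpr h)

theorem intBinom_zero_right (x : ℤ) : intBinom x 0 = 1 := by
  simp [intBinom]

theorem intBinom_one_right (x : ℤ) : intBinom x 1 = x := by
  simp [intBinom]

theorem intBinom_add_one (x y : ℤ) :
    intBinom (x + 1) y = intBinom x y + intBinom x (y - 1) := by
  rcases lt_trichotomy y 0 with h | rfl | h
  · rw [intBinom_of_neg h, intBinom_of_neg h, intBinom_of_neg (by lia), add_zero]
  · rw [intBinom_zero_right, intBinom_zero_right, intBinom_of_neg (by lia), add_zero]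
  · lift y to ℕ using h.le
    obtain ⟨m, rfl⟩ : ∃ m, y = m + 1 := ⟨y - 1, by lia⟩
    have hm : (((m + 1 : ℕ) : ℤ) - 1) = (m : ℤ) := by push_cast; ring
    rw [hm]
    simp only [intBinom, Int.natCast_nonneg, if_true, Int.toNat_natCast]
    rw [Ring.choose_succ_succ, add_comm]

/-- The value of the symbol of a ball at `(j, d)`, with `r` added to the upper and `s` to the lower
entry. -/
def ballValue (n k : ℕ) (r s j d : ℤ) : ℤ := intBinom ((n : ℤ) - j - d + r) ((k : ℤ) - d + s)

theorem ballValue_pascal (n k : ℕ) (r s j d : ℤ) :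
    ballValue n k r s j d = ballValue n k r s (j + 1) d + ballValue n k r s j (d + 1) := by
  have := intBinom_add_one ((n : ℤ) - j - d + r - 1) ((k : ℤ) - d + s)
  rw [sub_add_cancel] at this
  rw [ballValue, this, ballValue, ballValue]
  congr 2 <;> ring

theorem sum_map_descendants {g : ℤ → ℤ → ℤ} (hg : ∀ j d, g j d = g (j + 1) d + g j (d + 1))
    {b : Ball} {w : ℤ} (h : b.pos ≤ w) :
    ((descendants b w).map fun a => g a.pos a.delay).sum = g b.pos b.delay - g w b.delay := by
  induction w, h using Int.leInduction with
  | base => simp [descendants]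
  | succ w h ih =>
    rw [descendants_add_one h, Multiset.map_cons, Multiset.sum_cons, ih]
    linarith [hg w b.delay]

/-- During iteration `t` the wall at `w` stands for the symbol of a ball at `(w, t - 1)`. -/
theorem reflTransGen_invariant {g : ℤ → ℤ → ℤ} (hg : ∀ j d, g j d = g (j + 1) d + g j (d + 1))
    {t : ℕ} {x z : IterState} (h : Relation.ReflTransGen (ProcessBall t) x z)
    (hx : x.PendingDelay t) :
    g x.wall (t - 1) - (x.pending.map fun a => g a.pos a.delay).sum -
        (x.next.map fun a => g a.pos a.delay).sum =
      g z.wall (t - 1) - (z.pending.map fun a => g a.pos a.delay).sum -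
        (z.next.map fun a => g a.pos a.delay).sum := by
  induction h using Relation.ReflTransGen.head_induction_on with
  | refl => rfl
  | @head x y hxy _ ih =>
    rw [← ih (hxy.pendingDelay hx)]
    obtain ⟨b, D, hD, hb, rfl⟩ := (processBall_iff hx).mp hxy
    have hbt : b.delay = t := hx b (hD ▸ Multiset.mem_cons_self b D)
    have h1 := hg x.wall (t - 1)
    rw [sub_add_cancel] at h1
    simp only [hD, Multiset.map_cons, Multiset.sum_cons, Multiset.map_add, Multiset.sum_add,
      sum_map_descendants hg hb, hbt]
    linarith

theorem Iteration.invariant {g : ℤ → ℤ → ℤ} (hg : ∀ j d, g j d = g (j + 1) d + g j (d + 1))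
    {t : ℕ} {c c' : BallsWall} (h : Iteration t c c') (hc : ∀ b ∈ c.balls, (t : ℤ) ≤ b.delay) :
    g c.wall (t - 1) - (c.balls.map fun a => g a.pos a.delay).sum =
      g c'.wall (t - 1) - (c'.balls.map fun a => g a.pos a.delay).sum := by
  have := reflTransGen_invariant hg h (startIteration_pendingDelay hc)
  simp only [startIteration, Multiset.map_zero, Multiset.sum_zero, sub_zero] at this
  rw [← this, sub_sub, ← Multiset.sum_add, ← Multiset.map_add, Multiset.filter_add_not]

/-- At the end of each iteration, Pascal's rule splits the symbol of the wall into a symbol that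
remains and the symbol of the wall in the next iteration. -/
theorem IsOutput.sub_sum_eq {g : ℤ → ℤ → ℤ} (hg : ∀ j d, g j d = g (j + 1) d + g j (d + 1))
    {M : Multiset Ball} {out : ℕ → BallsWall} (h : IsOutput ⟨M, 0⟩ out)
    (hM : ∀ b ∈ M, 1 ≤ b.delay) (t : ℕ) :
    g 0 0 - (M.map fun a => g a.pos a.delay).sum =
      ∑ i ∈ Finset.range t, g ((out (i + 2)).wall + 1) i + g (out (t + 2)).wall t -
        ((out (t + 2)).balls.map fun a => g a.pos a.delay).sum := by
  have hM0 : ∀ b ∈ M, 0 ≤ b.delay := fun b hb => by linarith [hM b hb]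
  have hdelay := h.le_delay hM0
  induction t with
  | zero =>
    -- Iteration `0` processes no balls.
    have hstart : Iteration 0 ⟨M, 0⟩ ⟨M, 0⟩ := by
      have h1 : M.filter (fun b => b.delay ≤ 0) = 0 :=
        Multiset.filter_eq_nil.mpr fun b hb => by linarith [hM b hb]
      have h2 : M.filter (fun b => ¬ b.delay ≤ 0) = M :=
        Multiset.filter_eq_self.mpr fun b hb => by linarith [hM b hb]
      simp only [Iteration, startIteration, Nat.cast_zero, h1, h2]
      exact .refl
    have h1 : out 1 = ⟨M, 0⟩ := (h.1 ▸ h.2 0).eq_of_le_delay hstart (by simpa using hM0)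
    have := (h.2 1).invariant hg (hdelay 1)
    simpa [h1] using this
  | succ t ih =>
    have h1 := (h.2 (t + 2)).invariant hg (hdelay (t + 2))
    have h2 : ((t + 2 : ℕ) : ℤ) - 1 = t + 1 := by push_cast; ring
    have h3 := hg (out (t + 2)).wall t
    rw [h2] at h1
    rw [ih, Finset.sum_range_succ]
    push_cast
    linarith

/-! ### Counting the sets that contain an edge -/

theorem card_filter_inter_eq {n : ℕ} {e A L : Finset (Fin n)} (hA : Disjoint A e) (hL : L ⊆ A)
    (m : ℕ) :
    ((Finset.univ.filter fun f : Finset (Fin n) => f.card = m ∧ e ⊆ f ∧ f ∩ A = L).card : ℤ) =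
      intBinom ((n : ℤ) - e.card - A.card) ((m : ℤ) - e.card - L.card) := by
  have hAe : (A ∪ e).card = A.card + e.card := Finset.card_union_of_disjoint hA
  have hLe : Disjoint L e := hA.mono_left hL
  have hLecard : (L ∪ e).card = L.card + e.card := Finset.card_union_of_disjoint hLe
  rcases lt_or_ge m (L.card + e.card) with hm | hm
  · rw [intBinom_of_neg (by lia), Finset.filter_eq_empty_iff.mpr, Finset.card_empty, Nat.cast_zero]
    rintro f - ⟨hf, hef, hfA⟩
    have : L ∪ e ⊆ f := Finset.union_subset (hfA ▸ Finset.inter_subset_left) hef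
    have := Finset.card_le_card this
    lia
  · have hn : A.card + e.card ≤ n := by
      rw [← hAe]
      exact (Finset.card_le_univ _).trans_eq (Fintype.card_fin n)
    have h1 : (n : ℤ) - e.card - A.card = ((n - (A.card + e.card) : ℕ) : ℤ) := by lia
    have h2 : (m : ℤ) - e.card - L.card = ((m - (L.card + e.card) : ℕ) : ℤ) := by lia
    rw [h1, h2, intBinom_natCast, ← hAe]
    have h3 : n - (A ∪ e).card = (A ∪ e)ᶜ.card := by rw [Finset.card_compl, Fintype.card_fin]
    rw [h3, ← Finset.card_powersetCard, Nat.cast_inj]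
    refine Finset.card_nbij' (fun f => f \ (A ∪ e)) (fun g => g ∪ (L ∪ e)) ?_ ?_ ?_ ?_
    · intro f hf
      obtain ⟨hf, hef, hfA⟩ := (Finset.mem_filter.mp hf).2
      have hfi : f ∩ (A ∪ e) = L ∪ e := by
        rw [Finset.inter_union_distrib_left, hfA, Finset.inter_eq_right.mpr hef]
      refine Finset.mem_coe.mpr (Finset.mem_powersetCard.mpr ⟨fun x hx => ?_, ?_⟩)
      · exact Finset.mem_compl.mpr (Finset.mem_sdiff.mp hx).2
      · rw [Finset.card_sdiff, Finset.inter_comm, hfi, hLecard, hf]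
    · intro g hg
      obtain ⟨hg, hgc⟩ := Finset.mem_powersetCard.mp hg
      have hdisj : Disjoint g (A ∪ e) := Finset.subset_compl_iff_disjoint_right.mp hg
      refine Finset.mem_coe.mpr (Finset.mem_filter.mpr ⟨Finset.mem_univ _, ?_, ?_, ?_⟩)
      · rw [Finset.card_union_of_disjoint
          (hdisj.mono_right (Finset.union_subset_union hL subset_rfl)), hgc, hLecard]
        lia
      · exact Finset.subset_union_right.trans Finset.subset_union_right
      · rw [Finset.union_inter_distrib_right, Finset.union_inter_distrib_right,
          Finset.disjoint_iff_inter_eq_empty.mp (hdisj.mono_right Finset.subset_union_left),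
          Finset.inter_eq_left.mpr hL, Finset.disjoint_iff_inter_eq_empty.mp hA.symm]
        simp
    · intro f hf
      obtain ⟨-, hef, hfA⟩ := (Finset.mem_filter.mp hf).2
      have hfi : f ∩ (A ∪ e) = L ∪ e := by
        rw [Finset.inter_union_distrib_left, hfA, Finset.inter_eq_right.mpr hef]
      simp only [← hfi, Finset.sdiff_union_inter]
    · intro g hg
      have hdisj : Disjoint g (A ∪ e) :=
        Finset.subset_compl_iff_disjoint_right.mp (Finset.mem_powersetCard.mp hg).1
      simp only [Finset.union_sdiff_distrib, Finset.sdiff_eq_self_of_disjoint hdisj,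
        Finset.sdiff_eq_empty_iff_subset.mpr (Finset.union_subset_union hL (subset_refl e)),
        Finset.union_empty]

/-- The leaves of the tree partition the sets `f ⊇ e` whose complement contains a member of `B`:
the leaf labelled `(ℓ_v, ℓ_e)` collects those `f` with `f ∩ ℓ_v = ℓ_e`. -/
theorem card_filter_eq_sum_leafLabels {n : ℕ} {B : List (Finset (Fin n))} {e : Finset (Fin n)}
    (hB : ∀ b ∈ B, Disjoint b e) (m : ℕ) {Lv Le : Finset (Fin n)} (hLv : Disjoint Lv e)
    (hL : Le ⊆ Lv) :
    ((Finset.univ.filter fun f : Finset (Fin n) =>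
        f.card = m ∧ e ⊆ f ∧ f ∩ Lv = Le ∧ ∃ b ∈ B, Disjoint b f).card : ℤ) =
      ((leafLabels B Lv Le).map fun p =>
        intBinom ((n : ℤ) - e.card - p.1.card) ((m : ℤ) - e.card - p.2.card)).sum := by
  induction Lv, Le using leafLabels_induction (B := B) with
  | none Lv Le h =>
    rw [leafLabels_of_find?_eq_none h, Multiset.map_zero, Multiset.sum_zero,
      Finset.filter_eq_empty_iff.mpr, Finset.card_empty, Nat.cast_zero]
    rintro f - ⟨-, -, rfl, b, hb, hbf⟩
    have := List.find?_eq_none.mp h b hb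
    exact this (by simpa using hbf.mono_right Finset.inter_subset_left)
  | some Lv Le r h ih =>
    have hr := mem_and_disjoint_of_find?_eq_some h
    have hLv' : Disjoint (Lv ∪ r) e := Finset.disjoint_union_left.mpr ⟨hLv, hB r hr.1⟩
    rw [Finset.card_eq_sum_card_fiberwise (f := fun f => f ∩ (r \ Lv)) (t := (r \ Lv).powerset)
      (fun f _ => Finset.mem_coe.mpr (Finset.mem_powerset.mpr Finset.inter_subset_right)),
      ← Finset.add_sum_erase _ _ (Finset.empty_mem_powerset _), leafLabels_of_find?_eq_some h,
      Multiset.map_cons, Multiset.sum_cons, Nat.cast_add, Nat.cast_sum]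
    have hinter : ∀ f s : Finset (Fin n), s ⊆ r \ Lv →
        (f ∩ (Lv ∪ r) = Le ∪ s ↔ f ∩ Lv = Le ∧ f ∩ (r \ Lv) = s) := by
      intro f s hs
      have h1 : Le = (Le ∪ s) ∩ Lv := by
        ext x
        have h1 := @hL x
        have h2 := @hs x
        simp only [Finset.mem_sdiff, Finset.mem_inter, Finset.mem_union] at *
        tauto
      have h2 : s = (Le ∪ s) ∩ (r \ Lv) := by
        ext x
        have h1 := @hL x
        have h2 := @hs x
        simp only [Finset.mem_sdiff, Finset.mem_inter, Finset.mem_union] at *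
        tauto
      constructor
      · intro hf
        constructor
        · rw [h1, ← hf, Finset.inter_assoc, Finset.inter_eq_right.mpr Finset.subset_union_left]
        · rw [h2, ← hf, Finset.inter_assoc, Finset.inter_eq_right.mpr
            (Finset.sdiff_subset.trans Finset.subset_union_right)]
      · rintro ⟨rfl, rfl⟩
        rw [← Finset.inter_union_distrib_left, Finset.union_sdiff_self_eq_union]
    congr 1
    · rw [← card_filter_inter_eq hLv' (hL.trans Finset.subset_union_left), Finset.filter_filter,
        Nat.cast_inj]
      congr 1
      refine Finset.filter_congr fun f _ => ?_
      have h1 := hinter f ∅ (Finset.empty_subset _)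
      rw [Finset.union_empty] at h1
      rw [h1]
      constructor
      · rintro ⟨⟨h2, h3, h4, -⟩, h5⟩
        exact ⟨h2, h3, h4, h5⟩
      · rintro ⟨h2, h3, h4, h5⟩
        refine ⟨⟨h2, h3, h4, r, hr.1, ?_⟩, h5⟩
        rw [Finset.disjoint_left]
        intro x hxr hxf
        by_cases hx : x ∈ Lv
        · exact Finset.disjoint_left.mp hr.2 hxr (h4 ▸ Finset.mem_inter.mpr ⟨hxf, hx⟩)
        · exact Finset.notMem_empty x
            (h5 ▸ Finset.mem_inter.mpr ⟨hxf, Finset.mem_sdiff.mpr ⟨hxr, hx⟩⟩)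
    · let φ : Multiset (Finset (Fin n) × Finset (Fin n)) →+ ℤ :=
        Multiset.sumAddMonoidHom.comp (Multiset.mapAddMonoidHom fun p =>
          intBinom ((n : ℤ) - e.card - p.1.card) ((m : ℤ) - e.card - p.2.card))
      refine Eq.trans (Finset.sum_congr rfl fun s hs => ?_) (map_sum φ _ _).symm
      obtain ⟨hs0, hs⟩ := Finset.mem_erase.mp hs
      have hs := Finset.mem_powerset.mp hs
      refine Eq.trans ?_ (ih s (Finset.nonempty_iff_ne_empty.mpr hs0) hs hLv'
        (Finset.union_subset_union hL (hs.trans Finset.sdiff_subset)))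
      rw [Finset.filter_filter, Nat.cast_inj]
      congr 1
      refine Finset.filter_congr fun f _ => ?_
      rw [hinter f s hs]
      tauto

theorem mem_iterShadow_iff {n k : ℕ} {S : Finset (Finset (Fin n))}
    (hS : (S : Set (Finset (Fin n))).Sized k) {f : Finset (Fin n)} {i : ℕ} :
    f ∈ iterShadow i S ↔ f.card + i = k ∧ ∃ s ∈ S, f ⊆ s := by
  rw [iterShadow, Finset.mem_shadow_iterate_iff_exists_mem_card_add]
  constructor
  · rintro ⟨s, hs, hfs, hcard⟩
    exact ⟨by rw [← hcard, hS hs], s, hs, hfs⟩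
  · rintro ⟨hi, s, hs, hfs⟩
    exact ⟨s, hs, hfs, by rw [hi, hS hs]⟩

theorem OrderedHypergraph.exists_edge_subset_iff {n k : ℕ} {S : Finset (Finset (Fin n))}
    (hS : (S : Set (Finset (Fin n))).Sized k) (H : OrderedHypergraph k S) {f : Finset (Fin n)}
    (h₁ : 1 ≤ f.card) (h₂ : f.card ≤ k) : (∃ e ∈ H.edges, e ⊆ f) ↔ ¬ ∃ s ∈ S, f ⊆ s := by
  constructor
  · rintro ⟨e, he, hef⟩ ⟨s, hs, hfs⟩
    have he := ((H.mem_edges e).mp he).prop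
    exact he.2.2 ((mem_iterShadow_iff hS).mpr ⟨by lia, s, hs, hef.trans hfs⟩)
  · intro hf
    obtain ⟨e, hef, he⟩ := exists_minimal_le_of_wellFoundedLT
      (fun f : Finset (Fin n) => 1 ≤ f.card ∧ f.card ≤ k ∧ f ∉ iterShadow (k - f.card) S) f
      ⟨h₁, h₂, fun hcon => hf ((mem_iterShadow_iff hS).mp hcon).2⟩
    exact ⟨e, (H.mem_edges e).mpr he, hef⟩

/-- For `f ⊇ e_j`, the edge `e_j` is the first one contained in `f` if and only if the complement of
`f` contains a set of `B_j`. -/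
theorem OrderedHypergraph.exists_disjoint_dom_iff {n k : ℕ} {S : Finset (Finset (Fin n))}
    (H : OrderedHypergraph k S) (j : Fin H.edges.length) {f : Finset (Fin n)}
    (hf : H.edges.get j ⊆ f) :
    (∃ b ∈ H.dom j, Disjoint b f) ↔ ∀ g ∈ H.edges.take j, ¬ g ⊆ f := by
  constructor
  · rintro ⟨b, hb, hbf⟩ g hg hgf
    obtain ⟨x, hx⟩ := ((H.mem_dom j b).mp hb).prop.2 g hg
    obtain ⟨hxb, hxg⟩ := Finset.mem_inter.mp hx
    exact Finset.disjoint_left.mp hbf hxb (hgf hxg)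
  · intro h
    obtain ⟨b, hbf, hb⟩ := exists_minimal_le_of_wellFoundedLT
      (fun t : Finset (Fin n) => Disjoint t (H.edges.get j) ∧
        ∀ f ∈ H.edges.take j, (t ∩ f).Nonempty) fᶜ
      ⟨disjoint_compl_left.mono_right hf, fun g hg => by
        obtain ⟨x, hxg, hxf⟩ := Finset.not_subset.mp (h g hg)
        exact ⟨x, Finset.mem_inter.mpr ⟨Finset.mem_compl.mpr hxf, hxg⟩⟩⟩
    exact ⟨b, (H.mem_dom j b).mpr hb, disjoint_compl_left.mono_left hbf⟩

theorem OrderedHypergraph.card_filter_exists_edge_subset {n k : ℕ} {S : Finset (Finset (Fin n))}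
    (H : OrderedHypergraph k S) (m : ℕ) :
    ((Finset.univ.filter fun f : Finset (Fin n) => f.card = m ∧ ∃ e ∈ H.edges, e ⊆ f).card : ℤ) =
      ((initialConfiguration H).balls.map fun b =>
        intBinom ((n : ℤ) - b.pos - b.delay) ((m : ℤ) - b.delay)).sum := by
  classical
  let F (j : Fin H.edges.length) : Finset (Finset (Fin n)) := Finset.univ.filter fun f =>
    f.card = m ∧ H.edges.get j ⊆ f ∧ f ∩ ∅ = ∅ ∧ ∃ b ∈ H.dom j, Disjoint b f
  have hF : ∀ j f, f ∈ F j ↔ f.card = m ∧ H.edges.get j ⊆ f ∧ ∀ g ∈ H.edges.take j, ¬ g ⊆ f := by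
    intro j f
    simp only [F, Finset.mem_filter, Finset.mem_univ, true_and, Finset.inter_empty]
    exact and_congr_right fun _ => and_congr_right fun hf => H.exists_disjoint_dom_iff j hf
  have hmem : ∀ i j : Fin H.edges.length, i < j → H.edges.get i ∈ H.edges.take j := fun i j hij =>
    List.mem_take_iff_getElem.mpr ⟨i, by have := i.2; lia, rfl⟩
  have hdisj : ∀ i j : Fin H.edges.length, i < j → Disjoint (F i) (F j) := by
    intro i j hij
    rw [Finset.disjoint_left]
    intro f hi hj
    exact ((hF j f).mp hj).2.2 _ (hmem i j hij) ((hF i f).mp hi).2.1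
  have hunion : (Finset.univ.filter fun f : Finset (Fin n) =>
      f.card = m ∧ ∃ e ∈ H.edges, e ⊆ f) = Finset.univ.biUnion F := by
    ext f
    simp only [Finset.mem_filter, Finset.mem_univ, true_and, Finset.mem_biUnion, hF]
    constructor
    · rintro ⟨hf, e, he, hef⟩
      obtain ⟨i, hi⟩ := List.mem_iff_get.mp he
      obtain ⟨j, -, hj⟩ := exists_minimal_le_of_wellFoundedLT
        (fun j : Fin H.edges.length => H.edges.get j ⊆ f) i (by rwa [hi])
      refine ⟨j, hf, hj.prop, fun g hg hgf => ?_⟩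
      obtain ⟨l, hl, rfl⟩ := List.mem_take_iff_getElem.mp hg
      have hlj : (⟨l, by lia⟩ : Fin H.edges.length) < j := by rw [Fin.lt_def]; simp only; lia
      exact hlj.not_ge (hj.le_of_le hgf hlj.le)
    · rintro ⟨j, hf, hj, -⟩
      exact ⟨hf, _, List.get_mem _ _, hj⟩
  rw [hunion, Finset.card_biUnion (fun i _ j _ hij => by
    rcases lt_or_gt_of_ne hij with h | h
    · exact hdisj i j h
    · exact (hdisj j i h).symm), Nat.cast_sum]
  let φ : Multiset Ball →+ ℤ := Multiset.sumAddMonoidHom.comp (Multiset.mapAddMonoidHom fun b =>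
    intBinom ((n : ℤ) - b.pos - b.delay) ((m : ℤ) - b.delay))
  refine Eq.trans (Finset.sum_congr rfl fun j _ => ?_) (map_sum φ _ _).symm
  refine (card_filter_eq_sum_leafLabels (fun b hb => ((H.mem_dom j b).mp hb).prop.1) m
    (Finset.disjoint_empty_left _) subset_rfl).trans ?_
  simp only [φ, AddMonoidHom.comp_apply, Multiset.coe_mapAddMonoidHom,
    Multiset.coe_sumAddMonoidHom, Multiset.map_map, Function.comp, treeLeafLabels]
  congr 2
  funext p
  congr 1 <;> simp only [leafBall] <;> ring

/-- The shadows of `S` are counted by the initial balls. -/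
theorem OrderedHypergraph.card_iterShadow {n k : ℕ} {S : Finset (Finset (Fin n))}
    (hS : (S : Set (Finset (Fin n))).Sized k) (H : OrderedHypergraph k S) {i : ℕ} (hi : i < k) :
    ((iterShadow i S).card : ℤ) = intBinom n ((k : ℤ) - i) -
      ((initialConfiguration H).balls.map fun b =>
        intBinom ((n : ℤ) - b.pos - b.delay) ((k : ℤ) - i - b.delay)).sum := by
  have hki : (k : ℤ) - i = ((k - i : ℕ) : ℤ) := by lia
  rw [hki, ← H.card_filter_exists_edge_subset, intBinom_natCast, eq_sub_iff_add_eq]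
  have h1 : iterShadow i S = (Finset.powersetCard (k - i) Finset.univ).filter
      fun f => ¬ ∃ e ∈ H.edges, e ⊆ f := by
    ext f
    rw [mem_iterShadow_iff hS, Finset.mem_filter, Finset.mem_powersetCard_univ]
    constructor
    · rintro ⟨hf, h⟩
      refine ⟨by lia, ?_⟩
      rw [H.exists_edge_subset_iff hS (by lia) (by lia)]
      exact not_not.mpr h
    · rintro ⟨hf, h⟩
      rw [H.exists_edge_subset_iff hS (by lia) (by lia), not_not] at h
      exact ⟨by lia, h⟩
  have h2 : (Finset.univ.filter fun f : Finset (Fin n) => f.card = k - i ∧ ∃ e ∈ H.edges, e ⊆ f) =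
      (Finset.powersetCard (k - i) Finset.univ).filter fun f => ∃ e ∈ H.edges, e ⊆ f := by
    ext f
    simp
  rw [h1, h2, add_comm]
  have := Finset.card_filter_add_card_filter_not (s := Finset.powersetCard (k - i)
    (Finset.univ : Finset (Fin n))) (fun f => ∃ e ∈ H.edges, e ⊆ f)
  rw [Finset.card_powersetCard, Finset.card_univ, Fintype.card_fin] at this
  exact_mod_cast this

/-! ### Values of formal sums -/

/-- `BinomialSum.shiftedValue` as a homomorphism. -/
noncomputable def shiftedValueHom (r s : ℤ) : BinomialSum →+ ℤ :=
  Finsupp.liftAddHom fun p => AddMonoidHom.mulRight (intBinom (p.1 + r) (p.2 + s))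

theorem shiftedValueHom_apply (r s : ℤ) (E : BinomialSum) :
    shiftedValueHom r s E = E.shiftedValue r s := rfl

theorem shiftedValueHom_binomSymbol (r s x y : ℤ) :
    shiftedValueHom r s (binomSymbol x y) = intBinom (x + r) (y + s) := by
  simp [shiftedValueHom, binomSymbol]

theorem shiftedValueHom_ballsSum (r s : ℤ) (n k : ℕ) (M : Multiset Ball) :
    shiftedValueHom r s (ballsSum n k M) =
      (M.map fun b => ballValue n k r s b.pos b.delay).sum := by
  rw [ballsSum, map_multiset_sum, Multiset.map_map]
  simp only [Function.comp, shiftedValueHom_binomSymbol, ballValue]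

/-- The invariant at the end of iteration `k`, where the symbols of the last two walls are merged
again, which explains the repeated offset `k - 1` in the last entry. -/
theorem IsOutput.translationEq {n k : ℕ} (hk : 1 ≤ k) {M : Multiset Ball} {out : ℕ → BallsWall}
    (h : IsOutput ⟨M, 0⟩ out) (hM : ∀ b ∈ M, 1 ≤ b.delay) :
    (binomSymbol n k - ballsSum n k M).TranslationEq
      (∑ l : Fin k, binomSymbol (wallSequence n k (wallAtEnd out) l) ((k : ℤ) - (l : ℕ)) -
        ballsSum n k (ballsAtEnd out k)) := by
  intro r s
  obtain ⟨t, rfl⟩ : ∃ t, k = t + 1 := ⟨k - 1, by lia⟩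
  have hinv := h.sub_sum_eq (ballValue_pascal n (t + 1) r s) hM t
  rw [← shiftedValueHom_apply, ← shiftedValueHom_apply, map_sub, map_sub, map_sum,
    shiftedValueHom_ballsSum, shiftedValueHom_ballsSum]
  simp only [shiftedValueHom_binomSymbol]
  have h0 : intBinom ((n : ℤ) + r) (((t + 1 : ℕ) : ℤ) + s) = ballValue n (t + 1) r s 0 0 := by
    rw [ballValue, sub_zero, sub_zero, sub_zero]
  rw [h0, hinv, Fin.sum_univ_castSucc, Finset.sum_range]
  congr 2
  · refine Finset.sum_congr rfl fun i _ => ?_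
    have hi : (i : ℕ) + 1 < t + 1 := by lia
    simp only [wallSequence, wallAtEnd, Fin.val_castSucc, hi, if_true, ballValue]
    congr 1
    ring
  · simp only [wallSequence, wallAtEnd, Fin.val_last, lt_irrefl, if_false, ballValue]
    congr 1
    push_cast
    ring

/-! ### Shadow binomial decompositions -/

/-- The equations of a shadow decomposition form a triangular system: for `i = k - 1 - l` the
entries after the `l`-th contribute constants and the `l`-th contributes `binom (β_l) 1 = β_l`. -/
theorem eq_of_sum_intBinom_eq {k : ℕ} {β γ : Fin k → ℤ}
    (h : ∀ i : ℕ, i < k → ∑ l : Fin k, intBinom (β l) ((k : ℤ) - i - (l : ℕ)) =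
      ∑ l : Fin k, intBinom (γ l) ((k : ℤ) - i - (l : ℕ))) : β = γ := by
  funext l
  induction l using WellFoundedLT.induction with
  | ind l ih =>
    have hl := l.2
    have heq := h (k - 1 - l) (by lia)
    rw [← sub_eq_zero, ← Finset.sum_sub_distrib, Finset.sum_eq_single l] at heq
    · have hone : (k : ℤ) - ((k - 1 - l : ℕ) : ℤ) - (l : ℕ) = 1 := by lia
      rw [hone, intBinom_one_right, intBinom_one_right] at heq
      exact sub_eq_zero.mp heq
    · intro m _ hml
      rcases lt_or_gt_of_ne hml with hlt | hgt
      · rw [ih m hlt, sub_self]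
      · have hgt := Fin.lt_def.mp hgt
        rcases (show (l : ℕ) + 1 ≤ m from hgt).eq_or_lt with hm | hm
        · have h0 : (k : ℤ) - ((k - 1 - l : ℕ) : ℤ) - (m : ℕ) = 0 := by lia
          rw [h0, intBinom_zero_right, intBinom_zero_right, sub_self]
        · rw [intBinom_of_neg (by lia), intBinom_of_neg (by lia), sub_self]
    · exact fun hl => absurd (Finset.mem_univ l) hl

theorem theorem4 (n k : ℕ) (hk : 1 ≤ k) (S : Finset (Finset (Fin n)))
    (hS : (S : Set (Finset (Fin n))).Sized k) (H : OrderedHypergraph k S) :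
    ¬ CanTerminateAbruptly (initialConfiguration H) ∧
    (∃! out : ℕ → BallsWall, IsOutput (initialConfiguration H) out) ∧
    ∀ out : ℕ → BallsWall, IsOutput (initialConfiguration H) out →
      (∀ β : Fin k → ℤ, IsShadowBinomialDecomposition k S β ↔
        β = wallSequence n k (wallAtEnd out)) ∧
      (S.card : ℤ) =
        (binomSymbol n k - ballsSum n k (initialConfiguration H).balls).value ∧
      (binomSymbol n k - ballsSum n k (initialConfiguration H).balls).TranslationEq
        (∑ l : Fin k, binomSymbol (wallSequence n k (wallAtEnd out) l) ((k : ℤ) - (l : ℕ)) -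
          ballsSum n k (ballsAtEnd out k)) ∧
      ∀ b ∈ ballsAtEnd out k, (k : ℤ) + 1 ≤ b.delay := by
  have hone : ∀ b ∈ (initialConfiguration H).balls, 1 ≤ b.delay := fun b hb =>
    H.one_le_delay Finset.univ hb
  have hzero : ∀ b ∈ (initialConfiguration H).balls, 0 ≤ b.delay := fun b hb => by
    linarith [hone b hb]
  obtain ⟨out₀, hout₀⟩ := H.exists_isOutput
  refine ⟨hout₀.not_canTerminateAbruptly hzero, ⟨out₀, hout₀, fun out hout =>
    hout₀.unique hout hzero⟩, fun out hout => ?_⟩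
  have htrans := hout.translationEq (n := n) (M := (initialConfiguration H).balls) hk hone
  have hdelay : ∀ b ∈ ballsAtEnd out k, (k : ℤ) + 1 ≤ b.delay := fun b hb => by
    exact_mod_cast hout.le_delay hzero (k + 1) b hb
  have hcard : ∀ i : ℕ, i < k → ((iterShadow i S).card : ℤ) =
      (binomSymbol n k - ballsSum n k (initialConfiguration H).balls).shiftedValue 0 (-i) := by
    intro i hi
    rw [H.card_iterShadow hS hi, ← shiftedValueHom_apply, map_sub, shiftedValueHom_binomSymbol,
      shiftedValueHom_ballsSum, add_zero, ← sub_eq_add_neg]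
    congr 3
    funext b
    rw [ballValue, add_zero]
    congr 1
    ring
  -- Shifting the lower entries by `-i` turns the identity into the formula for `|Δ^i(S)|`; the
  -- remaining balls vanish because their delays exceed `k`.
  have hsum : ∀ i : ℕ, i < k → ((iterShadow i S).card : ℤ) =
      ∑ l : Fin k, intBinom (wallSequence n k (wallAtEnd out) l) ((k : ℤ) - i - (l : ℕ)) := by
    intro i hi
    rw [hcard i hi, htrans 0 (-i), ← shiftedValueHom_apply, map_sub, map_sum,
      shiftedValueHom_ballsSum, Multiset.sum_eq_zero, sub_zero]
    · refine Finset.sum_congr rfl fun l _ => ?_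
      rw [shiftedValueHom_binomSymbol, add_zero]
      congr 1
      ring
    · intro x hx
      obtain ⟨b, hb, rfl⟩ := Multiset.mem_map.mp hx
      have := hdelay b hb
      exact intBinom_of_neg (by lia)
  refine ⟨fun β => ⟨fun hβ => ?_, ?_⟩, ?_, htrans, hdelay⟩
  · exact eq_of_sum_intBinom_eq fun i hi => (hβ.2.2 i hi).symm.trans (hsum i hi)
  · rintro rfl
    have hmono : ∀ a b : ℕ, a ≤ b → wallAtEnd out a ≤ wallAtEnd out b := fun a b hab =>
      hout.wall_mono (Nat.succ_le_succ hab)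
    refine ⟨fun i j hij hj => ?_, fun i j hij => ?_, hsum⟩
    · have hij := Fin.lt_def.mp hij
      have := hmono (i + 1) (j + 1) (by lia)
      simp only [wallSequence, hj, if_true, (show (i : ℕ) + 1 < k by lia)]
      lia
    · have hij := Fin.lt_def.mp hij
      have hj := j.2
      have hi : (i : ℕ) + 1 < k := by lia
      simp only [wallSequence, hi, if_true]
      split_ifs with h
      · have := hmono (i + 1) (j + 1) (by lia)
        lia
      · have := hmono (i + 1) k (by lia)
        lia
  · have := hcard 0 hk
    simpa [iterShadow, BinomialSum.value] using this
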